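/- **Setting.** A quantum circuit $c=(\rho,U,\mathcal M)$ on $n$ qubits consists of a density matrix $\rho$, a product $U=U_L\cdots U_1$ of unitary gates, and a measurement $\mathcal M=\{E_x : x\in\{0,1\}^k\}$ (positive semidefinite operators with $\sum_xE_x=1$). Its output distribution on $\{0,1\}^k$ is $\mathcal P(x)=\mathrm{Tr}(U\rho U^\dagger E_x)$. A string $S\in\{0,1,\bullet\}^k$ denotes the set of outcomes that agree with $S$ wherever $S_i\neq\bullet$, and $\mathcal P(S)=\sum_{x\in S}\mathcal P(x)$. Let $A$ be a finite alphabet and $\mathcal C=\{c_a : a\in A^*\}$ a uniform family of quantum circuits, where $c_a$ has $n_a$ qubits, $k_a$ outcome bits and output distribution $\mathcal P_a$. Of uniformity only the following is used: the length of $a$ is at most polynomial in $n_a$, and $k_a$ can be computed (in unary) from $a$ in time polynomial in $n_a$. Algorithms are classical randomized algorithms with fair coin flips (multi-stack, equivalently multi-tape, machines). Running times are numbers of elementary steps and are bounded for every outcome of the coin flips. A precision $\varepsilon>0$ is given to an algorithm as $\lceil 1/\varepsilon\rceil$ in unary, and a failure probability $\delta>0$ as $\max(0,\lceil\log_2(1/\delta)\rceil)$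 in unary. Estimates of probabilities are output as binary expansions $w_0.w_1w_2\ldots$ of finite length. * A *poly-box* over $\mathcal C$ is an algorithm that, for all $a\in A^*$, $\varepsilon,\delta>0$ and $S\in\{0,1,\bullet\}^{k_a}$, computes from $(a,\varepsilon,\delta,S)$ an estimate $\hat p$ with $\Pr(|\mathcal P_a(S)-\hat p|\ge\varepsilon)\le\delta$, in time at most a fixed polynomial in $n_a$, $\lceil1/\varepsilon\rceil$ and $\max(0,\lceil\log_2(1/\delta)\rceil)$. * A distribution is *$t$-sparse* if at most $t$ outcomes have non-zero probability, and *$\varepsilon$-approximately $t$-sparse* if it is within $L_1$ distance $\varepsilon$ of a $t$-sparse distribution. The family $\mathbb P=\{\mathcal P_a\}$ is *poly-sparse* if there is a polynomial $P$ such that for all $\varepsilon>0$ and $a\in A^*$, $\mathcal P_a$ is $\varepsilon$-approximately $t$-sparse for every natural number $t\ge P(k_a/\varepsilon)$. * An *$\varepsilon$-simulator* of $\mathcal C$ is a single algorithm that, for all $a\in A^*$ and $\varepsilon>0$, outputs from $(a,\varepsilon)$ a sample from some distribution $\mathcal P_a^{\varepsilon}$ on $\{0,1\}^{k_a}$ with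 $\sum_x|\mathcal P_a(x)-\mathcal P_a^{\varepsilon}(x)|\le\varepsilon$, in time at most a fixed polynomial in $n_a$ and $\lceil 1/\varepsilon\rceil$. **Theorem.** If there exists a poly-box over $\mathcal C$ and the family $\mathbb P$ is poly-sparse, then there exists an $\varepsilon$-simulator of $\mathcal C$. -/

import Mathlib

open scoped ComplexOrder ENNReal
open Matrix

/-! ## Quantum circuits and the Born rule -/

/-- A quantum circuit `(ρ, U, M)` on `n` qubits: an initial density matrix, a finite sequence of
unitary gates (listed in the order in which they are applied) and a measurement
`{E_x | x ∈ {0,1}^k}`.  The `2 ^ n`-dimensional Hilbert space has the bit strings of length `n` as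
its basis. -/
structure QuantumCircuit where
  /-- the number of qubits -/
  n : ℕ
  /-- the number of outcome bits -/
  k : ℕ
  /-- the initial state -/
  state : Matrix (Fin n → Bool) (Fin n → Bool) ℂ
  state_posSemidef : state.PosSemidef
  state_trace : state.trace = 1
  /-- the gates `U₁, …, U_L`, first applied gate first -/
  gates : List (Matrix.unitaryGroup (Fin n → Bool) ℂ)
  /-- the measurement operators -/
  effect : (Fin k → Bool) → Matrix (Fin n → Bool) (Fin n → Bool) ℂ
  effect_posSemidef : ∀ x, (effect x).PosSemidef
  effect_sum : ∑ x, effect x = 1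

namespace QuantumCircuit

/-- The total unitary `U = U_L ⋯ U₁`. -/
def unitary (c : QuantumCircuit) : Matrix (Fin c.n → Bool) (Fin c.n → Bool) ℂ :=
  (c.gates.reverse.prod : Matrix.unitaryGroup (Fin c.n → Bool) ℂ)

/-- The Born rule `𝒫(x) = Tr(U ρ U† E_x)`. -/
noncomputable def bornProb (c : QuantumCircuit) (x : Fin c.k → Bool) : ℝ :=
  (c.unitary * c.state * c.unitaryᴴ * c.effect x).trace.re

theorem bornProb_nonneg (c : QuantumCircuit) (x : Fin c.k → Bool) : 0 ≤ c.bornProb x := by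
  obtain ⟨m, v, hv⟩ := Matrix.posSemidef_iff_eq_sum_vecMulVec.mp (c.effect_posSemidef x)
  have h : (0 : ℂ) ≤ (c.unitary * c.state * c.unitaryᴴ * c.effect x).trace := by
    rw [hv, Matrix.mul_sum, Matrix.trace_sum]
    refine Finset.sum_nonneg fun i _ => ?_
    rw [Matrix.mul_vecMulVec, Matrix.trace_vecMulVec, dotProduct_comm]
    exact (c.state_posSemidef.mul_mul_conjTranspose_same c.unitary).dotProduct_mulVec_nonneg _
  exact (Complex.le_def.mp h).1

theorem sum_bornProb (c : QuantumCircuit) : ∑ x, c.bornProb x = 1 := by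
  have hU : c.unitaryᴴ * c.unitary = 1 :=
    Matrix.mem_unitaryGroup_iff'.mp (c.gates.reverse.prod).2
  simp only [bornProb]
  rw [← Complex.re_sum, ← Matrix.trace_sum, ← Matrix.mul_sum, c.effect_sum, Matrix.mul_one,
    Matrix.trace_mul_comm, ← Matrix.mul_assoc, hU, Matrix.one_mul, c.state_trace, Complex.one_re]

/-- The output distribution `𝒫` of the circuit on `{0,1}^k`. -/
noncomputable def dist (c : QuantumCircuit) : PMF (Fin c.k → Bool) :=
  PMF.ofFintype (fun x => ENNReal.ofReal (c.bornProb x)) (by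
    rw [← ENNReal.ofReal_sum_of_nonneg fun x _ => c.bornProb_nonneg x, c.sum_bornProb,
      ENNReal.ofReal_one])

end QuantumCircuit

/-- The event (a set of outcomes) denoted by `S ∈ {0,1,•}^k`; the wild card `•` is `none`. -/
def patternEvent {k : ℕ} (S : Fin k → Option Bool) : Finset (Fin k → Bool) :=
  Finset.univ.filter fun x => ∀ i, S i = none ∨ S i = some (x i)

/-- The probability `𝒫(S) = ∑_{x ∈ S} Tr(U ρ U† E_x)` of the event `S ∈ {0,1,•}^k`. -/
noncomputable def QuantumCircuit.eventProb (c : QuantumCircuit) (S : Fin c.k → Option Bool) : ℝ :=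
  ∑ x ∈ patternEvent S, c.bornProb x

/-! ## Distances and sparsity of distributions -/

/-- The `L₁` distance of two distributions on a finite set. -/
noncomputable def l1Dist {α : Type*} [Fintype α] (p q : PMF α) : ℝ :=
  ∑ x, |(p x).toReal - (q x).toReal|

/-- At most `t` outcomes have non-zero probability. -/
def IsSparse {α : Type*} (t : ℕ) (p : PMF α) : Prop :=
  p.support.encard ≤ t

/-- `ε`-approximately `t`-sparse: within `L₁` distance `ε` of a `t`-sparse distribution. -/
def IsApproxSparse {α : Type*} [Fintype α] (ε : ℝ) (t : ℕ) (p : PMF α) : Prop :=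
  ∃ q : PMF α, IsSparse t q ∧ l1Dist p q ≤ ε

/-- A family of distributions `𝒫_a` on `{0,1}^{k_a}` is poly-sparse if, for one polynomial `P`,
every `𝒫_a` is `ε`-approximately `t`-sparse whenever `t ≥ P (k_a / ε)`. -/
def IsPolySparse {ι : Type*} {k : ι → ℕ} (p : ∀ a, PMF (Fin (k a) → Bool)) : Prop :=
  ∃ P : Polynomial ℝ, ∀ ε : ℝ, 0 < ε → ∀ (a : ι) (t : ℕ),
    P.eval ((k a : ℝ) / ε) ≤ t → IsApproxSparse ε t (p a)

/-! ## Classical randomized algorithms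

The machine model is a program acting on finitely many stacks over a finite alphabet (that is, a
multi-tape Turing machine written as a structured program), with fair coin flips.  One step
executes one elementary command, which inspects or changes only the top symbol of one stack. -/

/-- The stack alphabet: the letters of the alphabet `A` in which circuits are described, the two
bits, and a wild card symbol. -/
inductive StackSymbol (A : Type*)
  | letter (a : A)
  | bit (b : Bool)
  | wild

/-- Randomized programs.  Stacks are numbered by `ℕ`; a program mentions only finitely many. -/
inductive Prog (A : Type*)
  /-- do nothing -/
  | skip
  /-- push the symbol `x` on stack `r` -/
  | push (r : ℕ) (x : StackSymbol A)
  /-- remove the top symbol of stack `r`, if there is one -/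
  | pop (r : ℕ)
  /-- flip a fair coin and push the resulting bit on stack `r` -/
  | flip (r : ℕ)
  /-- run `p`, then `q` -/
  | seq (p q : Prog A)
  /-- branch on the top symbol of stack `r` (`none` if the stack is empty) -/
  | ite (r : ℕ) (test : Option (StackSymbol A) → Bool) (p q : Prog A)
  /-- repeat `p` as long as the top symbol of stack `r` passes the test -/
  | loop (r : ℕ) (test : Option (StackSymbol A) → Bool) (p : Prog A)

/-- A configuration: the commands still to be executed, and the contents of the stacks (top symbol
first). -/
structure Cfg (A : Type*) where
  todo : List (Prog A)
  stk : ℕ → List (StackSymbol A)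

namespace Cfg

variable {A : Type*}

/-- One computation step; a configuration with nothing left to do is halted and stays put. -/
noncomputable def step : Cfg A → PMF (Cfg A)
  | ⟨[], s⟩ => PMF.pure ⟨[], s⟩
  | ⟨.skip :: l, s⟩ => PMF.pure ⟨l, s⟩
  | ⟨.push r x :: l, s⟩ => PMF.pure ⟨l, Function.update s r (x :: s r)⟩
  | ⟨.pop r :: l, s⟩ => PMF.pure ⟨l, Function.update s r (s r).tail⟩
  | ⟨.flip r :: l, s⟩ =>
      (PMF.uniformOfFintype Bool).map fun b => ⟨l, Function.update s r (.bit b :: s r)⟩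
  | ⟨.seq p q :: l, s⟩ => PMF.pure ⟨p :: q :: l, s⟩
  | ⟨.ite r test p q :: l, s⟩ => PMF.pure ⟨(if test (s r).head? then p else q) :: l, s⟩
  | ⟨.loop r test p :: l, s⟩ =>
      PMF.pure ⟨if test (s r).head? then p :: .loop r test p :: l else l, s⟩

/-- The distribution of the configuration after `T` steps. -/
noncomputable def run : ℕ → Cfg A → PMF (Cfg A)
  | 0, c => PMF.pure c
  | T + 1, c => c.step.bind (run T)

end Cfg

namespace Prog

variable {A : Type*}

/-- The start configuration: the `i`-th input string is on stack `i`; all other stacks are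
empty. -/
def start (p : Prog A) (inputs : List (List (StackSymbol A))) : Cfg A :=
  ⟨[p], fun r => inputs.getD r []⟩

/-- Whatever the coin flips, `p` halts on these inputs within `T` steps. -/
def HaltsWithin (p : Prog A) (inputs : List (List (StackSymbol A))) (T : ℕ) : Prop :=
  ∀ c ∈ ((p.start inputs).run T).support, c.todo = []

/-- The distribution of the content of stack `0` after `T` steps: the distribution of the output
string, if `p` halts within `T` steps. -/
noncomputable def output (p : Prog A) (inputs : List (List (StackSymbol A))) (T : ℕ) :
    PMF (List (StackSymbol A)) :=
  ((p.start inputs).run T).map fun c => c.stk 0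

end Prog

/-! ## Input and output conventions -/

section Encoding

variable {A : Type*}

/-- A word over the description alphabet, as an input string. -/
def encodeWord (a : List A) : List (StackSymbol A) := a.map .letter

/-- A natural number in unary. -/
def encodeUnary (m : ℕ) : List (StackSymbol A) := List.replicate m (.bit true)

/-- A bit string. -/
def encodeBits {k : ℕ} (x : Fin k → Bool) : List (StackSymbol A) := List.ofFn fun i => .bit (x i)

/-- An event `S ∈ {0,1,•}^k`. -/
def encodePattern {k : ℕ} (S : Fin k → Option Bool) : List (StackSymbol A) :=
  List.ofFn fun i => (S i).elim .wild .bit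

/-- The dyadic rational `w₀.w₁w₂w₃…` (in binary) denoted by an output string `w`; symbols other
than the bit `1` count as `0`. -/
noncomputable def estimateValue : List (StackSymbol A) → ℝ
  | [] => 0
  | .bit true :: w => 1 + estimateValue w / 2
  | _ :: w => estimateValue w / 2

end Encoding

/-- A precision `ε > 0` is handed to an algorithm as the integer `⌈1/ε⌉`, in unary. -/
noncomputable def precisionIndex (ε : ℝ) : ℕ := ⌈1 / ε⌉₊

/-- A failure probability `δ > 0` is handed to an algorithm as the integer `⌈log₂ (1/δ)⌉`
(`0` if `δ ≥ 1`), in unary. -/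
noncomputable def confidenceIndex (δ : ℝ) : ℕ := ⌈Real.logb 2 (1 / δ)⌉₊

/-! ## Families of circuits, poly-boxes and simulators -/

section Families

variable {A : Type*}

/-- The uniformity conditions on a family `{c_a | a ∈ A*}` as far as they concern classical
algorithms that are given the index `a`: the description `a` has length at most polynomial in the
number of qubits, and the number of outcome bits of `c_a` can be computed from `a` (in unary) in
time polynomial in the number of qubits.  The gate sequence itself need not be computable. -/
structure IsUniform (C : List A → QuantumCircuit) : Prop where
  length_le : ∃ P : Polynomial ℕ, ∀ a, a.length ≤ P.eval (C a).n
  outcome_bits : ∃ (M : Prog A) (P : Polynomial ℕ), ∀ a,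
    M.HaltsWithin [encodeWord a] (P.eval (C a).n) ∧
      M.output [encodeWord a] (P.eval (C a).n) = PMF.pure (encodeUnary (C a).k)

/-- `M` is a poly-box over `C`: given `a`, `ε`, `δ` and `S ∈ {0,1,•}^{k_a}`, it computes in time
`poly(n, 1/ε, log(1/δ))` an estimate `p̂` with `Pr(|𝒫_a(S) - p̂| ≥ ε) ≤ δ`. -/
def IsPolyBox (C : List A → QuantumCircuit) (M : Prog A) : Prop :=
  ∃ P : Polynomial ℕ, ∀ (a : List A) (ε δ : ℝ), 0 < ε → 0 < δ →
    ∀ S : Fin (C a).k → Option Bool,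
      let inputs := [encodeWord a, encodeUnary (precisionIndex ε),
        encodeUnary (confidenceIndex δ), encodePattern S]
      let T := P.eval ((C a).n + precisionIndex ε + confidenceIndex δ)
      M.HaltsWithin inputs T ∧
        (M.output inputs T).toOuterMeasure {w | ε ≤ |(C a).eventProb S - estimateValue w|}
          ≤ ENNReal.ofReal δ

/-- `M` is an `ε`-simulator of `C`: given `a` and `ε`, it outputs in time `poly(n, 1/ε)` a sample
from a distribution `𝒬` on `{0,1}^{k_a}` within `L₁` distance `ε` of `𝒫_a`. -/
def IsEpsilonSimulator (C : List A → QuantumCircuit) (M : Prog A) : Prop :=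
  ∃ P : Polynomial ℕ, ∀ (a : List A) (ε : ℝ), 0 < ε →
    let inputs := [encodeWord a, encodeUnary (precisionIndex ε)]
    let T := P.eval ((C a).n + precisionIndex ε)
    M.HaltsWithin inputs T ∧
      ∃ Q : PMF (Fin (C a).k → Bool),
        M.output inputs T = Q.map encodeBits ∧ l1Dist (C a).dist Q ≤ ε

end Families

/-! ## Big-step semantics of programs -/

theorem PMF.bind_congr_support {α β : Type*} {p : PMF α} {f g : α → PMF β}
    (h : ∀ a ∈ p.support, f a = g a) : p.bind f = p.bind g := by
  ext b
  simp only [PMF.bind_apply]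
  refine tsum_congr fun a => ?_
  by_cases ha : p a = 0
  · simp [ha]
  · rw [h a ((PMF.mem_support_iff _ _).2 ha)]

/-- The contents of the stacks. -/
abbrev Stacks (A : Type*) := ℕ → List (StackSymbol A)

section Semantics

variable {A : Type*}

theorem Cfg.run_nil (T : ℕ) (s : Stacks A) : Cfg.run T ⟨[], s⟩ = PMF.pure ⟨[], s⟩ := by
  induction T with
  | zero => rfl
  | succ T ih => rw [Cfg.run, Cfg.step, PMF.pure_bind, ih]

theorem Cfg.run_add (m n : ℕ) (c : Cfg A) : Cfg.run (m + n) c = (Cfg.run m c).bind (Cfg.run n) := by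
  induction m generalizing c with
  | zero => rw [Nat.zero_add, Cfg.run, PMF.pure_bind]
  | succ m ih =>
    rw [Nat.succ_add, Cfg.run, Cfg.run, PMF.bind_bind]
    exact congrArg _ (funext ih)

theorem Cfg.step_append (p : Prog A) (l l' : List (Prog A)) (s : Stacks A) :
    Cfg.step ⟨p :: l ++ l', s⟩ = (Cfg.step ⟨p :: l, s⟩).map fun c => ⟨c.todo ++ l', c.stk⟩ := by
  cases p <;> simp [Cfg.step, PMF.pure_map, PMF.map_comp, Function.comp_def]
  split_ifs <;> simp

/-- Started with the commands `l` on the stacks `s`, the machine halts within `T` steps, whatever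
the coin flips, and `D` is the distribution of the stacks at that time. -/
def Exec (l : List (Prog A)) (s : Stacks A) (T : ℕ) (D : PMF (Stacks A)) : Prop :=
  Cfg.run T ⟨l, s⟩ = D.map (Cfg.mk [])

theorem Exec.eq_map_stk {l : List (Prog A)} {s : Stacks A} {T : ℕ} {D : PMF (Stacks A)}
    (h : Exec l s T D) : D = (Cfg.run T ⟨l, s⟩).map Cfg.stk := by
  rw [h, PMF.map_comp]
  exact (PMF.map_id D).symm

theorem exec_of_halts {l : List (Prog A)} {s : Stacks A} {T : ℕ}
    (h : ∀ c ∈ (Cfg.run T ⟨l, s⟩).support, c.todo = []) :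
    Exec l s T ((Cfg.run T ⟨l, s⟩).map Cfg.stk) := by
  rw [Exec, PMF.map_comp]
  conv_lhs => rw [← PMF.bind_pure (Cfg.run T ⟨l, s⟩)]
  refine PMF.bind_congr_support fun c hc => ?_
  have := h c hc
  cases c
  simp_all

theorem Exec.halts {l : List (Prog A)} {s : Stacks A} {T : ℕ} {D : PMF (Stacks A)}
    (h : Exec l s T D) : ∀ c ∈ (Cfg.run T ⟨l, s⟩).support, c.todo = [] := by
  intro c hc
  rw [h, PMF.mem_support_map_iff] at hc
  obtain ⟨s', -, rfl⟩ := hc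
  rfl

theorem exec_nil (s : Stacks A) (T : ℕ) : Exec [] s T (PMF.pure s) := by
  rw [Exec, Cfg.run_nil, PMF.pure_map]

theorem Exec.mono {l : List (Prog A)} {s : Stacks A} {T T' : ℕ} {D : PMF (Stacks A)}
    (h : Exec l s T D) (hT : T ≤ T') : Exec l s T' D := by
  obtain ⟨n, rfl⟩ := Nat.exists_eq_add_of_le hT
  rw [Exec, Cfg.run_add, h, PMF.bind_map]
  exact congrArg _ (funext fun s => Cfg.run_nil n s)

theorem Exec.append {l l' : List (Prog A)} {s : Stacks A} {T T' : ℕ} {D : PMF (Stacks A)}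
    {E : Stacks A → PMF (Stacks A)} (h : Exec l s T D)
    (h' : ∀ s' ∈ D.support, Exec l' s' T' (E s')) : Exec (l ++ l') s (T + T') (D.bind E) := by
  induction T generalizing l s D with
  | zero =>
    have h0 := h.halts ⟨l, s⟩ (by simp [Cfg.run])
    simp only at h0
    subst h0
    have hD := h.eq_map_stk
    rw [Cfg.run_nil, PMF.pure_map] at hD
    subst hD
    rw [PMF.pure_bind]
    exact (h' s (by simp)).mono (by omega)
  | succ T ih =>
    have hD := h.eq_map_stk
    cases l with
    | nil =>
      rw [Cfg.run_nil, PMF.pure_map] at hD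
      subst hD
      rw [PMF.pure_bind]
      exact (h' s (by simp)).mono (by omega)
    | cons p l =>
      rw [Exec, Nat.succ_add, Cfg.run, Cfg.step_append, PMF.bind_map]
      have key : ∀ c ∈ (Cfg.step ⟨p :: l, s⟩).support,
          Cfg.run (T + T') ⟨c.todo ++ l', c.stk⟩ =
            ((((Cfg.run T c).map Cfg.stk).bind E).map (Cfg.mk [])) := by
        intro c hc
        refine ih (l := c.todo) (s := c.stk) (exec_of_halts fun c' hc' => ?_) fun s' hs' => ?_
        · refine h.halts c' ?_
          rw [Cfg.run, PMF.mem_support_bind_iff]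
          exact ⟨c, hc, hc'⟩
        · refine h' s' ?_
          rw [hD, Cfg.run]
          rw [PMF.mem_support_map_iff] at hs' ⊢
          obtain ⟨c', hc', rfl⟩ := hs'
          exact ⟨c', (PMF.mem_support_bind_iff _ _ _).2 ⟨c, hc, hc'⟩, rfl⟩
      refine (PMF.bind_congr_support key).trans ?_
      simp only [hD, Cfg.run, PMF.map_bind, PMF.bind_bind]

theorem exec_of_step {p : Prog A} {l l' : List (Prog A)} {s s' : Stacks A} {T : ℕ}
    {D : PMF (Stacks A)} (hs : Cfg.step ⟨p :: l, s⟩ = PMF.pure ⟨l', s'⟩) (h : Exec l' s' T D) :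
    Exec (p :: l) s (T + 1) D := by
  rw [Exec, Cfg.run, hs, PMF.pure_bind, h]

theorem exec_skip (s : Stacks A) : Exec [.skip] s 1 (PMF.pure s) :=
  exec_of_step rfl (exec_nil s 0)

theorem exec_push (r : ℕ) (x : StackSymbol A) (s : Stacks A) :
    Exec [.push r x] s 1 (PMF.pure (Function.update s r (x :: s r))) :=
  exec_of_step rfl (exec_nil _ 0)

theorem exec_pop (r : ℕ) (s : Stacks A) :
    Exec [.pop r] s 1 (PMF.pure (Function.update s r (s r).tail)) :=
  exec_of_step rfl (exec_nil _ 0)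

theorem exec_flip (r : ℕ) (s : Stacks A) :
    Exec [.flip r] s 1 ((PMF.uniformOfFintype Bool).map fun b =>
      Function.update s r (.bit b :: s r)) := by
  simp only [Exec, Cfg.run, Cfg.step, PMF.bind_map, PMF.map_comp]
  rfl

theorem Exec.seq {p q : Prog A} {s : Stacks A} {T T' : ℕ} {D : PMF (Stacks A)}
    {E : Stacks A → PMF (Stacks A)} (h : Exec [p] s T D)
    (h' : ∀ s' ∈ D.support, Exec [q] s' T' (E s')) :
    Exec [.seq p q] s (T + T' + 1) (D.bind E) :=
  exec_of_step rfl (h.append h')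

/-- Sequential composition after a deterministic first part. -/
theorem Exec.pure_seq {p q : Prog A} {s s' : Stacks A} {T T' : ℕ} {D : PMF (Stacks A)}
    (h : Exec [p] s T (PMF.pure s')) (h' : Exec [q] s' T' D) :
    Exec [.seq p q] s (T + T' + 1) D := by
  have := h.seq (E := fun _ => D) (q := q) (T' := T') (by simpa using h')
  rwa [PMF.pure_bind] at this

theorem exec_ite_true {r : ℕ} {test : Option (StackSymbol A) → Bool} {p q : Prog A} {s : Stacks A}
    {T : ℕ} {D : PMF (Stacks A)} (ht : test (s r).head? = true) (h : Exec [p] s T D) :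
    Exec [.ite r test p q] s (T + 1) D :=
  exec_of_step (by simp [Cfg.step, ht]) h

theorem exec_ite_false {r : ℕ} {test : Option (StackSymbol A) → Bool} {p q : Prog A} {s : Stacks A}
    {T : ℕ} {D : PMF (Stacks A)} (ht : test (s r).head? = false) (h : Exec [q] s T D) :
    Exec [.ite r test p q] s (T + 1) D :=
  exec_of_step (by simp [Cfg.step, ht]) h

theorem exec_loop_false {r : ℕ} {test : Option (StackSymbol A) → Bool} {p : Prog A} {s : Stacks A}
    (ht : test (s r).head? = false) : Exec [.loop r test p] s 1 (PMF.pure s) :=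
  exec_of_step (by simp [Cfg.step, ht]) (exec_nil _ 0)

theorem exec_loop_true {r : ℕ} {test : Option (StackSymbol A) → Bool} {p : Prog A} {s : Stacks A}
    {T T' : ℕ} {D : PMF (Stacks A)} {E : Stacks A → PMF (Stacks A)}
    (ht : test (s r).head? = true) (h : Exec [p] s T D)
    (h' : ∀ s' ∈ D.support, Exec [.loop r test p] s' T' (E s')) :
    Exec [.loop r test p] s (T + T' + 1) (D.bind E) :=
  exec_of_step (by simp [Cfg.step, ht]) (h.append h')

theorem exec_loop_pure {r : ℕ} {test : Option (StackSymbol A) → Bool} {p : Prog A}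
    {s s' : Stacks A} {T T' : ℕ} {D : PMF (Stacks A)}
    (ht : test (s r).head? = true) (h : Exec [p] s T (PMF.pure s'))
    (h' : Exec [.loop r test p] s' T' D) :
    Exec [.loop r test p] s (T + T' + 1) D := by
  have := exec_loop_true (E := fun _ => D) (T' := T') ht h (by simpa using h')
  rwa [PMF.pure_bind] at this

/-! ### Growth of the stacks -/

theorem Cfg.length_stk_step {c c' : Cfg A} (h : c' ∈ c.step.support) (r : ℕ) :
    (c'.stk r).length ≤ (c.stk r).length + 1 := by
  obtain ⟨l, s⟩ := c
  rcases l with _ | ⟨p, l⟩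
  · simp [Cfg.step] at h
    subst h
    simp
  · cases p <;> simp [Cfg.step] at h
    case flip r' =>
      rcases h with h | h <;> subst h <;> rcases eq_or_ne r r' with rfl | hr <;> simp [*]
    case push r' x =>
      subst h; rcases eq_or_ne r r' with rfl | hr <;> simp [*]
    case pop r' =>
      subst h; rcases eq_or_ne r r' with rfl | hr <;> simp [*]; omega
    all_goals subst h; simp

theorem Cfg.length_stk_run {T : ℕ} {c c' : Cfg A} (h : c' ∈ (c.run T).support) (r : ℕ) :
    (c'.stk r).length ≤ (c.stk r).length + T := by
  induction T generalizing c with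
  | zero =>
    simp [Cfg.run] at h
    subst h
    simp
  | succ T ih =>
    rw [Cfg.run, PMF.mem_support_bind_iff] at h
    obtain ⟨d, hd, hc⟩ := h
    have := ih hc
    have := Cfg.length_stk_step hd r
    omega

theorem Exec.length_le {l : List (Prog A)} {s s' : Stacks A} {T : ℕ} {D : PMF (Stacks A)}
    (h : Exec l s T D) (hs : s' ∈ D.support) (r : ℕ) : (s' r).length ≤ (s r).length + T := by
  rw [h.eq_map_stk, PMF.mem_support_map_iff] at hs
  obtain ⟨c, hc, rfl⟩ := hs
  exact Cfg.length_stk_run hc r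

/-! ### Locality -/

/-- All stacks mentioned in the program have numbers below `R`. -/
def Prog.UsesBelow (R : ℕ) : Prog A → Prop
  | .skip => True
  | .push r _ => r < R
  | .pop r => r < R
  | .flip r => r < R
  | .seq p q => p.UsesBelow R ∧ q.UsesBelow R
  | .ite r _ p q => r < R ∧ p.UsesBelow R ∧ q.UsesBelow R
  | .loop r _ p => r < R ∧ p.UsesBelow R

theorem Prog.UsesBelow.mono {R R' : ℕ} (hR : R ≤ R') {p : Prog A} (h : p.UsesBelow R) :
    p.UsesBelow R' := by
  induction p with
  | skip => trivial
  | push r x => exact lt_of_lt_of_le h hR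
  | pop r => exact lt_of_lt_of_le h hR
  | flip r => exact lt_of_lt_of_le h hR
  | seq p q ihp ihq => exact ⟨ihp h.1, ihq h.2⟩
  | ite r t p q ihp ihq => exact ⟨lt_of_lt_of_le h.1 hR, ihp h.2.1, ihq h.2.2⟩
  | loop r t p ih => exact ⟨lt_of_lt_of_le h.1 hR, ih h.2⟩

theorem Prog.exists_usesBelow (p : Prog A) : ∃ R, p.UsesBelow R := by
  induction p with
  | skip => exact ⟨0, trivial⟩
  | push r x => exact ⟨r + 1, Nat.lt_succ_self r⟩
  | pop r => exact ⟨r + 1, Nat.lt_succ_self r⟩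
  | flip r => exact ⟨r + 1, Nat.lt_succ_self r⟩
  | seq p q ihp ihq =>
    obtain ⟨m, hm⟩ := ihp
    obtain ⟨n, hn⟩ := ihq
    exact ⟨max m n, hm.mono (le_max_left _ _), hn.mono (le_max_right _ _)⟩
  | ite r t p q ihp ihq =>
    obtain ⟨m, hm⟩ := ihp
    obtain ⟨n, hn⟩ := ihq
    exact ⟨max (r + 1) (max m n), by omega, hm.mono (by omega), hn.mono (by omega)⟩
  | loop r t p ih =>
    obtain ⟨m, hm⟩ := ih
    exact ⟨max (r + 1) m, by omega, hm.mono (by omega)⟩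

/-- The stacks `low` below `R`, followed by the stacks listed in `hi`. -/
def mem (R : ℕ) (low : Stacks A) (hi : List (List (StackSymbol A))) : Stacks A := fun r =>
  if r < R then low r else hi.getD (r - R) []

theorem mem_of_lt {R r : ℕ} (hr : r < R) (low : Stacks A) (hi : List (List (StackSymbol A))) :
    mem R low hi r = low r := if_pos hr

@[simp] theorem mem_add (R i : ℕ) (low : Stacks A) (hi : List (List (StackSymbol A))) :
    mem R low hi (R + i) = hi.getD i [] := by simp [mem]

theorem update_mem_of_lt {R r : ℕ} (hr : r < R) (low : Stacks A)
    (hi : List (List (StackSymbol A))) (x : List (StackSymbol A)) :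
    Function.update (mem R low hi) r x = mem R (Function.update low r x) hi := by
  funext q
  rcases eq_or_ne q r with rfl | hq
  · simp [mem, hr]
  · simp [mem, hq]

theorem update_mem_add {R i : ℕ} (low : Stacks A) (hi : List (List (StackSymbol A)))
    (h : i < hi.length) (x : List (StackSymbol A)) :
    Function.update (mem R low hi) (R + i) x = mem R low (hi.set i x) := by
  funext q
  rcases eq_or_ne q (R + i) with rfl | hq
  · simp [h]
  · rw [Function.update_of_ne hq]
    by_cases hR : q < R
    · simp [mem, hR]
    · simp only [mem, hR, if_false, List.getD_eq_getElem?_getD]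
      rw [List.getElem?_set_ne (by omega)]

theorem Cfg.step_mem {R : ℕ} {l : List (Prog A)} (hl : ∀ p ∈ l, p.UsesBelow R) (s : Stacks A)
    (hi : List (List (StackSymbol A))) :
    Cfg.step ⟨l, mem R s hi⟩ = (Cfg.step ⟨l, s⟩).map fun c => ⟨c.todo, mem R c.stk hi⟩ := by
  rcases l with _ | ⟨p, l⟩
  · simp [Cfg.step, PMF.pure_map]
  · have hp := hl p (by simp)
    cases p <;> simp only [Prog.UsesBelow] at hp <;>
      simp [Cfg.step, PMF.pure_map, PMF.map_comp, Function.comp_def, update_mem_of_lt, mem_of_lt,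
        hp]

theorem Cfg.usesBelow_step {R : ℕ} {c c' : Cfg A} (hc : ∀ p ∈ c.todo, p.UsesBelow R)
    (h : c' ∈ c.step.support) : ∀ p ∈ c'.todo, p.UsesBelow R := by
  obtain ⟨l, s⟩ := c
  rcases l with _ | ⟨p, l⟩
  · simp [Cfg.step] at h
    subst h
    simp
  · simp only [List.mem_cons, forall_eq_or_imp] at hc
    obtain ⟨hp, hl⟩ := hc
    cases p <;> simp only [Prog.UsesBelow] at hp <;> simp [Cfg.step] at h
    case flip => rcases h with h | h <;> subst h <;> exact hl
    case seq => subst h; simpa [hp] using hl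
    case ite =>
      subst h
      simp only [List.mem_cons, forall_eq_or_imp]
      split_ifs <;> simp [hp] <;> exact hl
    case loop => subst h; dsimp; split_ifs <;> simpa [hp, Prog.UsesBelow] using hl
    all_goals subst h; exact hl

theorem Cfg.run_mem {R T : ℕ} {l : List (Prog A)} (hl : ∀ p ∈ l, p.UsesBelow R) (s : Stacks A)
    (hi : List (List (StackSymbol A))) :
    Cfg.run T ⟨l, mem R s hi⟩ = (Cfg.run T ⟨l, s⟩).map fun c => ⟨c.todo, mem R c.stk hi⟩ := by
  induction T generalizing l s with
  | zero => simp [Cfg.run, PMF.pure_map]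
  | succ T ih =>
    rw [Cfg.run, Cfg.step_mem hl, PMF.bind_map, Cfg.run, PMF.map_bind]
    exact PMF.bind_congr_support fun c hc => ih (Cfg.usesBelow_step hl hc) c.stk

theorem Exec.mem {R T : ℕ} {p : Prog A} (hp : p.UsesBelow R) {s : Stacks A} {D : PMF (Stacks A)}
    (h : Exec [p] s T D) (hi : List (List (StackSymbol A))) :
    Exec [p] (mem R s hi) T (D.map fun s => mem R s hi) := by
  rw [Exec, Cfg.run_mem (by simpa using hp), h, PMF.map_comp, PMF.map_comp]
  rfl

end Semantics

/-! ## Sums over bit strings and suffix masses -/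

/-- The sum of `f` over all bit strings of length `j`. -/
def sumBits : ℕ → (List Bool → ℝ) → ℝ
  | 0, f => f []
  | j + 1, f => sumBits j fun D => f (false :: D) + f (true :: D)

theorem sumBits_mono {j : ℕ} {f g : List Bool → ℝ} (h : ∀ D, D.length = j → f D ≤ g D) :
    sumBits j f ≤ sumBits j g := by
  induction j generalizing f g with
  | zero => exact h [] rfl
  | succ j ih =>
    exact ih fun D hD => add_le_add (h _ (by simp [hD])) (h _ (by simp [hD]))

theorem sumBits_congr {j : ℕ} {f g : List Bool → ℝ} (h : ∀ D, D.length = j → f D = g D) :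
    sumBits j f = sumBits j g :=
  le_antisymm (sumBits_mono fun D hD => (h D hD).le) (sumBits_mono fun D hD => (h D hD).ge)

theorem sumBits_add (j : ℕ) (f g : List Bool → ℝ) :
    sumBits j (fun D => f D + g D) = sumBits j f + sumBits j g := by
  induction j generalizing f g with
  | zero => rfl
  | succ j ih =>
    simp only [sumBits, ← ih]
    exact sumBits_congr fun D _ => by ring

theorem sum_fin_succ_bool {j : ℕ} (F : (Fin (j + 1) → Bool) → ℝ) :
    ∑ x, F x = ∑ x : Fin j → Bool, (F (Fin.cons false x) + F (Fin.cons true x)) := by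
  rw [← (Fin.consEquiv fun _ : Fin (j + 1) => Bool).sum_comp, Fintype.sum_prod_type,
    Fintype.sum_bool, ← Finset.sum_add_distrib]
  exact Finset.sum_congr rfl fun x _ => add_comm _ _

theorem sum_ofFn_eq_sumBits (j : ℕ) (f : List Bool → ℝ) :
    ∑ x : Fin j → Bool, f (List.ofFn x) = sumBits j f := by
  induction j generalizing f with
  | zero => simp [sumBits]
  | succ j ih =>
    rw [sum_fin_succ_bool, sumBits, ← ih]
    exact Finset.sum_congr rfl fun x _ => by simp [List.ofFn_succ]

/-- The total weight of the bit strings that end in `D`. -/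
noncomputable def suffixMass {k : ℕ} (h : (Fin k → Bool) → ℝ) (D : List Bool) : ℝ :=
  open Classical in ∑ x, if D <:+ List.ofFn x then h x else 0

theorem suffixMass_nil {k : ℕ} (h : (Fin k → Bool) → ℝ) : suffixMass h [] = ∑ x, h x := by
  simp [suffixMass]

theorem suffixMass_nonneg {k : ℕ} {h : (Fin k → Bool) → ℝ} (hh : ∀ x, 0 ≤ h x) (D : List Bool) :
    0 ≤ suffixMass h D :=
  Finset.sum_nonneg fun x _ => by split_ifs <;> simp [hh]

theorem suffixMass_le_sum {k : ℕ} {h : (Fin k → Bool) → ℝ} (hh : ∀ x, 0 ≤ h x) (D : List Bool) :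
    suffixMass h D ≤ ∑ x, h x :=
  Finset.sum_le_sum fun x _ => by split_ifs <;> simp [hh]

theorem List.cons_isSuffix_cases {D l : List Bool} (hD : D <:+ l) (hl : D.length < l.length) :
    (false :: D <:+ l ∧ ¬ true :: D <:+ l) ∨ (true :: D <:+ l ∧ ¬ false :: D <:+ l) := by
  obtain ⟨t, rfl⟩ := hD
  rcases List.eq_nil_or_concat t with rfl | ⟨t, b, rfl⟩
  · simp at hl
  · have h (c : Bool) : c :: D <:+ t ++ [b] ++ D ↔ c = b := by
      constructor
      · rintro ⟨u, hu⟩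
        have : u ++ [c] ++ D = t ++ [b] ++ D := by simpa using hu
        have := List.append_cancel_right this
        exact List.singleton_inj.1 (List.append_inj' this rfl).2
      · rintro rfl
        exact ⟨t, by simp⟩
    rw [List.concat_eq_append, h, h]
    cases b <;> simp

theorem suffixMass_cons {k : ℕ} (h : (Fin k → Bool) → ℝ) {D : List Bool} (hD : D.length < k) :
    suffixMass h D = suffixMass h (false :: D) + suffixMass h (true :: D) := by
  simp only [suffixMass]
  rw [← Finset.sum_add_distrib]
  refine Finset.sum_congr rfl fun x _ => ?_
  by_cases hs : D <:+ List.ofFn x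
  · rcases List.cons_isSuffix_cases hs (by simpa using hD) with h | h <;> simp [hs, h]
  · have (b : Bool) : ¬ b :: D <:+ List.ofFn x := fun hb => hs ((List.suffix_cons b D).trans hb)
    simp [hs, this]

theorem suffixMass_ofFn {k : ℕ} (h : (Fin k → Bool) → ℝ) (x : Fin k → Bool) :
    suffixMass h (List.ofFn x) = h x := by
  have (y : Fin k → Bool) : List.ofFn x <:+ List.ofFn y ↔ y = x := by
    constructor
    · intro hs
      exact (List.ofFn_injective (hs.eq_of_length (by simp))).symm
    · rintro rfl
      exact List.suffix_rfl
  simp [suffixMass, this]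

theorem sumBits_suffixMass {k : ℕ} (h : (Fin k → Bool) → ℝ) {j : ℕ} (hj : j ≤ k) :
    sumBits j (suffixMass h) = ∑ x, h x := by
  induction j with
  | zero => exact suffixMass_nil h
  | succ j ih =>
    rw [sumBits, ← ih (by omega)]
    exact sumBits_congr fun D hD => (suffixMass_cons h (by omega)).symm

/-! ## Sampling bit by bit -/

/-- The probability that bits drawn one after the other, the last one first, from the conditional
distributions `q` yield the string `D`. -/
noncomputable def chainProb (q : List Bool → PMF Bool) : List Bool → ℝ
  | [] => 1
  | b :: D => chainProb q D * (q D b).toReal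

theorem PMF.toReal_bool_add (q : PMF Bool) : (q false).toReal + (q true).toReal = 1 := by
  have := q.tsum_coe
  rw [tsum_bool] at this
  rw [← ENNReal.toReal_add (q.apply_ne_top _) (q.apply_ne_top _), this, ENNReal.toReal_one]

/-- The error of the conditional distribution `q D`, weighted with the mass of `D`. -/
noncomputable def stepError (m : List Bool → ℝ) (q : List Bool → PMF Bool) (D : List Bool) : ℝ :=
  |m D * (q D false).toReal - m (false :: D)| + |m D * (q D true).toReal - m (true :: D)|

theorem sumBits_chainProb_sub_le (m : List Bool → ℝ) (q : List Bool → PMF Bool) {E : ℝ} {k : ℕ}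
    (hm : m [] = 1) (hE : ∀ j < k, sumBits j (stepError m q) ≤ E) {j : ℕ} (hj : j ≤ k) :
    sumBits j (fun D => |chainProb q D - m D|) ≤ j * E := by
  induction j with
  | zero => simp [sumBits, chainProb, hm]
  | succ j ih =>
    have h1 : sumBits (j + 1) (fun D => |chainProb q D - m D|) ≤
        sumBits j (fun D => |chainProb q D - m D| + stepError m q D) := by
      change sumBits j _ ≤ _
      refine sumBits_mono fun D _ => ?_
      have key (b : Bool) : |chainProb q (b :: D) - m (b :: D)| ≤
          |chainProb q D - m D| * (q D b).toReal + |m D * (q D b).toReal - m (b :: D)| := by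
        have e : chainProb q (b :: D) - m (b :: D) = (chainProb q D - m D) * (q D b).toReal +
            (m D * (q D b).toReal - m (b :: D)) := by
          rw [chainProb]; ring
        rw [e]
        refine (abs_add_le _ _).trans ?_
        rw [abs_mul, abs_of_nonneg (ENNReal.toReal_nonneg (a := q D b))]
      have h := PMF.toReal_bool_add (q D)
      calc _ ≤ _ := add_le_add (key false) (key true)
        _ = |chainProb q D - m D| * ((q D false).toReal + (q D true).toReal) +
            stepError m q D := by rw [stepError]; ring
        _ = _ := by rw [h, mul_one]
    rw [sumBits_add] at h1
    have := ih (by omega)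
    have := hE j (by omega)
    push_cast
    linarith

/-- The string of `j` bits drawn bit by bit, the last one first. -/
noncomputable def chainLaw (q : List Bool → PMF Bool) : (j : ℕ) → PMF (Fin j → Bool)
  | 0 => PMF.pure Fin.elim0
  | j + 1 => (chainLaw q j).bind fun x => (q (List.ofFn x)).map fun b => Fin.cons b x

theorem toReal_chainLaw (q : List Bool → PMF Bool) {j : ℕ} (x : Fin j → Bool) :
    (chainLaw q j x).toReal = chainProb q (List.ofFn x) := by
  induction j with
  | zero => simp [chainLaw, chainProb, Subsingleton.elim x Fin.elim0]
  | succ j ih =>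
    have h : chainLaw q (j + 1) x =
        chainLaw q j (Fin.tail x) * q (List.ofFn (Fin.tail x)) (x 0) := by
      rw [chainLaw, PMF.bind_apply, tsum_eq_single (Fin.tail x)]
      · congr 1
        rw [PMF.map_apply, tsum_eq_single (x 0)]
        · simp
        · intro b hb
          rw [if_neg]
          intro hx
          exact hb (by rw [hx, Fin.cons_zero])
      · intro y hy
        rw [mul_eq_zero]
        right
        rw [PMF.map_apply, ENNReal.tsum_eq_zero]
        intro b
        rw [if_neg]
        rintro rfl
        simp at hy
    rw [h, ENNReal.toReal_mul, ih, List.ofFn_succ, chainProb]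
    rfl

/-- The string obtained from `D` by drawing `i` more bits. -/
noncomputable def extendLaw (q : List Bool → PMF Bool) : ℕ → List Bool → PMF (List Bool)
  | 0, D => PMF.pure D
  | i + 1, D => (q D).bind fun b => extendLaw q i (b :: D)

theorem chainLaw_bind_extendLaw (q : List Bool → PMF Bool) (i j : ℕ) :
    ((chainLaw q j).bind fun x => extendLaw q i (List.ofFn x)) =
      (chainLaw q (i + j)).map List.ofFn := by
  induction i generalizing j with
  | zero => rw [Nat.zero_add]; rfl
  | succ i ih =>
    rw [Nat.add_right_comm, Nat.add_assoc, ← ih (j + 1), chainLaw, PMF.bind_bind]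
    refine congrArg _ (funext fun x => ?_)
    rw [PMF.bind_map]
    simp [extendLaw, Function.comp_def, List.ofFn_succ]

theorem extendLaw_nil (q : List Bool → PMF Bool) (k : ℕ) :
    extendLaw q k [] = (chainLaw q k).map List.ofFn := by
  rw [← Nat.add_zero k, ← chainLaw_bind_extendLaw, chainLaw, PMF.pure_bind]
  simp

theorem stepError_le_two_mul {m : List Bool → ℝ} (q : List Bool → PMF Bool) {D : List Bool}
    (h0 : ∀ D, 0 ≤ m D) (h : m D = m (false :: D) + m (true :: D)) :
    stepError m q D ≤ 2 * m D := by
  have hq := PMF.toReal_bool_add (q D)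
  have key (b : Bool) : |m D * (q D b).toReal - m (b :: D)| ≤ m D * (q D b).toReal + m (b :: D) := by
    have := mul_nonneg (h0 D) (ENNReal.toReal_nonneg (a := q D b))
    have := h0 (b :: D)
    rw [abs_le]
    constructor <;> linarith
  have h1 := key false
  have h2 := key true
  have h3 : m D * (q D false).toReal + m D * (q D true).toReal = m D := by
    rw [← mul_add, hq, mul_one]
  rw [stepError]
  linarith

/-- Bit by bit sampling with conditional errors at most `η` from a distribution that is close to a
sparse one. -/
theorem l1Dist_chainLaw_le {k : ℕ} (p : PMF (Fin k → Bool)) (q : List Bool → PMF Bool)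
    {t : ℕ} {ε η : ℝ} (hp : IsApproxSparse ε t p) (hη : 0 ≤ η)
    (hq : ∀ D, D.length < k → stepError (suffixMass fun x => (p x).toReal) q D ≤ η) :
    l1Dist p (chainLaw q k) ≤ k * (t * η + 2 * ε) := by
  classical
  obtain ⟨r, hr, hrε⟩ := hp
  set m := suffixMass fun x => (p x).toReal with hm
  have hm0 : ∀ D, 0 ≤ m D := suffixMass_nonneg fun x => ENNReal.toReal_nonneg
  have hm1 : m [] = 1 := by
    have h' := congrArg ENNReal.toReal p.tsum_coe
    rw [tsum_fintype, ENNReal.toReal_sum fun x _ => p.apply_ne_top x, ENNReal.toReal_one] at h'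
    rw [hm, suffixMass_nil, h']
  let h : (Fin k → Bool) → ℝ := fun x => if r x = 0 then 2 * (p x).toReal else η
  have hh : ∀ x, 0 ≤ h x := fun x => by
    simp only [h]; split_ifs
    · positivity
    · exact hη
  have hsum : ∑ x, h x ≤ t * η + 2 * ε := by
    have hcard : ((Finset.univ.filter fun x => ¬ r x = 0).card : ℝ) ≤ t := by
      have : r.support = ((Finset.univ.filter fun x => ¬ r x = 0 : Finset _) : Set _) := by
        ext x; simp
      rw [IsSparse, this, Set.encard_coe_eq_coe_finsetCard] at hr
      exact_mod_cast hr
    have h1 : ∑ x ∈ Finset.univ.filter (fun x => r x = 0), (p x).toReal ≤ ε := by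
      refine le_trans ?_ hrε
      calc _ = ∑ x ∈ Finset.univ.filter (fun x => r x = 0), |(p x).toReal - (r x).toReal| := by
            refine Finset.sum_congr rfl fun x hx => ?_
            rw [(Finset.mem_filter.1 hx).2, ENNReal.toReal_zero, sub_zero,
              abs_of_nonneg ENNReal.toReal_nonneg]
        _ ≤ _ := Finset.sum_le_sum_of_subset_of_nonneg (Finset.filter_subset _ _)
            fun _ _ _ => abs_nonneg _
    simp only [h]
    rw [Finset.sum_ite, Finset.sum_const, ← Finset.mul_sum, nsmul_eq_mul]
    nlinarith
  have hE : ∀ j < k, sumBits j (stepError m q) ≤ t * η + 2 * ε := by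
    intro j hj
    rw [← sumBits_suffixMass h hj.le] at hsum
    refine le_trans (sumBits_mono fun D hD => ?_) hsum
    by_cases hD' : ∃ x, D <:+ List.ofFn x ∧ r x ≠ 0
    · obtain ⟨x, hx, hrx⟩ := hD'
      refine (hq D (by omega)).trans ?_
      have : (if D <:+ List.ofFn x then h x else 0) = η := by simp [h, hx, hrx]
      rw [← this]
      exact Finset.single_le_sum
        (f := fun x => if D <:+ List.ofFn x then h x else 0)
        (fun x _ => by split_ifs <;> simp [hh]) (Finset.mem_univ x)
    · push Not at hD'
      refine (stepError_le_two_mul q hm0 (suffixMass_cons _ (by omega))).trans (le_of_eq ?_)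
      rw [hm, suffixMass, suffixMass, Finset.mul_sum]
      refine Finset.sum_congr rfl fun x _ => ?_
      split_ifs with hx
      · simp [h, hD' x hx]
      · simp
  have := sumBits_chainProb_sub_le m q hm1 hE le_rfl
  refine le_trans (le_of_eq ?_) this
  rw [l1Dist, ← sum_ofFn_eq_sumBits]
  refine Finset.sum_congr rfl fun x _ => ?_
  rw [toReal_chainLaw, hm, suffixMass_ofFn, abs_sub_comm]

/-! ## Rejection sampling of one bit -/

/-- Up to `n` trials, each of which proposes a bit and accepts or rejects it; the result is the first
accepted bit or, if there is none, the last proposed one. -/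
noncomputable def rejectionLaw (τ : PMF (Bool × Bool)) : ℕ → Bool → PMF Bool
  | 0, c => PMF.pure c
  | n + 1, _ => τ.bind fun r => if r.2 then PMF.pure r.1 else rejectionLaw τ n r.1

theorem le_rejectionLaw (τ : PMF (Bool × Bool)) (b : Bool) (n : ℕ) (c : Bool) :
    (τ (b, true)).toReal * ∑ i ∈ Finset.range n,
      (1 - ((τ (false, true)).toReal + (τ (true, true)).toReal)) ^ i ≤
        (rejectionLaw τ n c b).toReal := by
  induction n generalizing c with
  | zero => simp
  | succ n ih =>
    have hτ : (τ (false, false)).toReal + (τ (true, false)).toReal =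
        1 - ((τ (false, true)).toReal + (τ (true, true)).toReal) := by
      have h := τ.tsum_coe
      rw [tsum_fintype] at h
      have h' := congrArg ENNReal.toReal h
      rw [ENNReal.toReal_sum fun x _ => τ.apply_ne_top x, Fintype.sum_prod_type] at h'
      simp at h'
      linarith
    have e : (rejectionLaw τ (n + 1) c b).toReal = (τ (b, true)).toReal +
        ((τ (false, false)).toReal * (rejectionLaw τ n false b).toReal +
          (τ (true, false)).toReal * (rejectionLaw τ n true b).toReal) := by
      rw [rejectionLaw, PMF.bind_apply, tsum_fintype, ENNReal.toReal_sum fun x _ =>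
        ENNReal.mul_ne_top (τ.apply_ne_top x) (PMF.apply_ne_top _ _), Fintype.sum_prod_type]
      cases b <;> simp <;> ring
    rw [e, Finset.sum_range_succ', ← hτ]
    simp only [pow_succ, pow_zero, ← Finset.sum_mul]
    rw [hτ]
    have h0 := ih false
    have h1 := ih true
    have := mul_le_mul_of_nonneg_left h0 (ENNReal.toReal_nonneg (a := τ (false, false)))
    have := mul_le_mul_of_nonneg_left h1 (ENNReal.toReal_nonneg (a := τ (true, false)))
    rw [← hτ] at *
    nlinarith

theorem mul_geom_sum_bounds {α : ℝ} (h0 : 0 ≤ α) (h1 : α ≤ 1) (n : ℕ) :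
    α * ∑ i ∈ Finset.range n, (1 - α) ^ i = 1 - (1 - α) ^ n ∧ n * (α * (1 - α) ^ n) ≤ 1 := by
  have e : α * ∑ i ∈ Finset.range n, (1 - α) ^ i = 1 - (1 - α) ^ n := by
    have := mul_neg_geom_sum (1 - α) n
    rwa [sub_sub_cancel] at this
  refine ⟨e, ?_⟩
  have h2 : (n : ℝ) * (1 - α) ^ n ≤ ∑ i ∈ Finset.range n, (1 - α) ^ i := by
    rw [← nsmul_eq_mul, ← Finset.card_range n, ← Finset.sum_const, Finset.card_range]
    exact Finset.sum_le_sum fun i hi =>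
      pow_le_pow_of_le_one (by linarith) (by linarith) (Finset.mem_range.1 hi).le
  have h3 : 0 ≤ (1 - α) ^ n := pow_nonneg (by linarith) n
  nlinarith

/-- Rejection sampling with acceptance probabilities close to a quarter of the masses `m₀`, `m₁`. -/
theorem rejectionLaw_error_le (τ : PMF (Bool × Bool)) {n : ℕ} (hn : 0 < n) (c : Bool)
    {m : Bool → ℝ} {η : ℝ} (h : ∀ b, |(τ (b, true)).toReal - m b / 4| ≤ η) (b : Bool) :
    |(m false + m true) * (rejectionLaw τ n c b).toReal - m b| ≤ 8 / n + 20 * η := by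
  set a : Bool → ℝ := fun b => (τ (b, true)).toReal with ha
  set α := a false + a true with hα
  set S := ∑ i ∈ Finset.range n, (1 - α) ^ i with hS
  set q : Bool → ℝ := fun b => (rejectionLaw τ n c b).toReal with hq
  have ha0 : ∀ b, 0 ≤ a b := fun b => ENNReal.toReal_nonneg
  have hq0 : ∀ b, a b * S ≤ q b := fun b => le_rejectionLaw τ b n c
  have hqs : q false + q true = 1 := PMF.toReal_bool_add _
  have hα0 : 0 ≤ α := add_nonneg (ha0 _) (ha0 _)
  have hα1 : α ≤ 1 := by
    have h' := congrArg ENNReal.toReal τ.tsum_coe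
    rw [tsum_fintype, ENNReal.toReal_sum fun x _ => τ.apply_ne_top x, Fintype.sum_prod_type] at h'
    simp at h'
    have := ENNReal.toReal_nonneg (a := τ (false, false))
    have := ENNReal.toReal_nonneg (a := τ (true, false))
    simp only [hα, ha]
    linarith
  obtain ⟨hgeo, hbern⟩ := mul_geom_sum_bounds hα0 hα1 n
  rw [← hS] at hgeo
  set β := (1 - α) ^ n with hβ
  have hβ0 : 0 ≤ β := pow_nonneg (by linarith) n
  have hβ1 : β ≤ 1 := pow_le_one₀ (by linarith) (by linarith)
  have hS0 : 0 ≤ S := Finset.sum_nonneg fun i _ => pow_nonneg (by linarith) i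
  have hη : 0 ≤ η := (abs_nonneg _).trans (h b)
  have hn' : (0 : ℝ) < n := by exact_mod_cast hn
  have hαβ : α * β ≤ 1 / n := by
    rw [le_div_iff₀ hn']; linarith
  obtain ⟨e, he⟩ : ∃ e : Bool → ℝ, ∀ b, m b = 4 * a b + e b :=
    ⟨fun b => m b - 4 * a b, fun b => by ring⟩
  have he' : ∀ b, |e b| ≤ 4 * η := by
    intro b
    have h1 := h b
    have : (τ (b, true)).toReal - m b / 4 = - (e b / 4) := by rw [he]; simp only [ha]; ring
    rw [this, abs_neg, abs_div, abs_of_pos (by norm_num : (0 : ℝ) < 4)] at h1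
    linarith
  obtain ⟨r, hr⟩ : ∃ r, q b = a b * S + r := ⟨q b - a b * S, by ring⟩
  have hr0 : 0 ≤ r := by have := hq0 b; linarith
  have hsplit : a false * S + a true * S = 1 - β := by rw [← hgeo, hα]; ring
  have hrβ : r ≤ β := by
    have h1 := hq0 false
    have h2 := hq0 true
    cases b <;> linarith
  have hab : a b ≤ α := by
    have h1 := ha0 false
    have h2 := ha0 true
    cases b <;> simp only [hα] <;> linarith
  have hS1 : a b * S ≤ 1 := by
    have := mul_le_mul_of_nonneg_right hab hS0
    linarith
  have hS1' : 0 ≤ a b * S := mul_nonneg (ha0 b) hS0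
  have hid : (m false + m true) * q b - m b =
      - (4 * (a b * β)) + (e false + e true) * (a b * S) - e b + 4 * (α * r) +
        (e false + e true) * r := by
    have : α * (a b * S) = a b * (1 - β) := by rw [← hgeo]; ring
    rw [he false, he true, he b, hr]
    have h4 : a false + a true = α := rfl
    linear_combination 4 * this + (4 * (a b * S + r)) * h4
  have hff : |e false + e true| ≤ 8 * η := (abs_add_le _ _).trans (by linarith [he' false, he' true])
  have b1 : |(e false + e true) * (a b * S)| ≤ 8 * η := by
    rw [abs_mul, abs_of_nonneg hS1']
    nlinarith [abs_nonneg (e false + e true)]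
  have b2 : |(e false + e true) * r| ≤ 8 * η := by
    rw [abs_mul, abs_of_nonneg hr0]
    nlinarith [abs_nonneg (e false + e true)]
  have b3 : a b * β ≤ 1 / n := (mul_le_mul_of_nonneg_right hab hβ0).trans hαβ
  have b4 : α * r ≤ 1 / n := (mul_le_mul_of_nonneg_left hrβ hα0).trans hαβ
  have b5 : 0 ≤ a b * β := mul_nonneg (ha0 b) hβ0
  have b6 : 0 ≤ α * r := mul_nonneg hα0 hr0
  have b7 := he' b
  have e8 : (8 : ℝ) / n = 8 * (1 / n) := by ring
  change |(m false + m true) * q b - m b| ≤ _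
  rw [hid, e8]
  rw [abs_le] at *
  constructor <;> linarith

/-! ## Acceptance of a proposed bit -/

section Accept

variable {A : Type*}

/-- Walk down the string `w`, stopping at each symbol with probability one half; accept if the
symbol where the walk stops is the bit `1`. -/
noncomputable def acceptLaw : List (StackSymbol A) → PMF Bool
  | [] => PMF.pure false
  | x :: w => (PMF.uniformOfFintype Bool).bind fun c =>
      if c then PMF.pure (open Classical in decide (x = .bit true)) else acceptLaw w

theorem PMF.toReal_uniform_bind {β : Type*} (f : Bool → PMF β) (y : β) :
    (((PMF.uniformOfFintype Bool).bind f) y).toReal =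
      (1 / 2) * (f false y).toReal + (1 / 2) * (f true y).toReal := by
  rw [PMF.bind_apply, tsum_bool, ENNReal.toReal_add
    (ENNReal.mul_ne_top (PMF.apply_ne_top _ _) (PMF.apply_ne_top _ _))
    (ENNReal.mul_ne_top (PMF.apply_ne_top _ _) (PMF.apply_ne_top _ _))]
  simp

theorem acceptLaw_true (w : List (StackSymbol A)) :
    (acceptLaw w true).toReal = estimateValue w / 2 := by
  induction w with
  | nil => simp [acceptLaw, estimateValue]
  | cons x w ih =>
    rw [acceptLaw, PMF.toReal_uniform_bind]
    simp only [Bool.false_eq_true, if_false, if_true, ih]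
    rcases x with a | (_ | _) | _ <;> simp [estimateValue] <;> ring

theorem PMF.bind_apply_le_add {α β : Type*} (μ : PMF α) (f : α → PMF β) (y : β) (s : Set α)
    {u : ℝ≥0∞} (h : ∀ a ∉ s, f a y ≤ u) : (μ.bind f) y ≤ u + μ.toOuterMeasure s := by
  rw [PMF.bind_apply, PMF.toOuterMeasure_apply]
  calc ∑' a, μ a * f a y ≤ ∑' a, (μ a * u + s.indicator μ a) := by
        refine ENNReal.tsum_le_tsum fun a => ?_
        by_cases ha : a ∈ s
        · rw [Set.indicator_of_mem ha]
          exact le_add_left (mul_le_of_le_one_right' (PMF.coe_le_one _ _))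
        · rw [Set.indicator_of_notMem ha, add_zero]
          exact mul_le_mul_right (h a ha) _
    _ = u + ∑' a, s.indicator μ a := by
        rw [ENNReal.tsum_add, ENNReal.tsum_mul_right, μ.tsum_coe, one_mul]

theorem abs_bind_acceptLaw_sub_le (μ : PMF (List (StackSymbol A))) {v ε δ : ℝ} (hv0 : 0 ≤ v)
    (hv1 : v ≤ 1) (hε : 0 ≤ ε) (hδ : 0 ≤ δ)
    (h : μ.toOuterMeasure {w | ε ≤ |v - estimateValue w|} ≤ ENNReal.ofReal δ) :
    |((μ.bind acceptLaw) true).toReal - v / 2| ≤ ε / 2 + δ := by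
  have toReal_le {y : Bool} {u : ℝ} (hu : 0 ≤ u)
      (hb : ∀ w ∉ {w : List (StackSymbol A) | ε ≤ |v - estimateValue w|},
        (acceptLaw w y).toReal ≤ u) : ((μ.bind acceptLaw) y).toReal ≤ u + δ := by
    have h1 := μ.bind_apply_le_add acceptLaw y {w | ε ≤ |v - estimateValue w|}
      (u := ENNReal.ofReal u) fun w hw => by
        rw [← ENNReal.ofReal_toReal ((acceptLaw w).apply_ne_top y)]
        exact ENNReal.ofReal_le_ofReal (hb w hw)
    have h2 := h1.trans (add_le_add_right h _)
    rw [← ENNReal.ofReal_add hu hδ] at h2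
    exact ENNReal.toReal_le_of_le_ofReal (by positivity) h2
  have ht := toReal_le (y := true) (u := (v + ε) / 2) (by linarith) fun w hw => by
    rw [Set.mem_ofPred_eq, not_le, abs_lt] at hw
    rw [acceptLaw_true]
    linarith
  have hf := toReal_le (y := false) (u := 1 - (v - ε) / 2) (by linarith) fun w hw => by
    rw [Set.mem_ofPred_eq, not_le, abs_lt] at hw
    have := PMF.toReal_bool_add (acceptLaw w)
    rw [acceptLaw_true] at this
    linarith
  have := PMF.toReal_bool_add (μ.bind acceptLaw)
  rw [abs_le]
  constructor <;> linarith

/-- One trial: propose a fair bit and accept it according to an estimate drawn from `μ`. -/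
noncomputable def trialLaw (μ : Bool → PMF (List (StackSymbol A))) : PMF (Bool × Bool) :=
  (PMF.uniformOfFintype Bool).bind fun b => ((μ b).bind acceptLaw).map fun r => (b, r)

theorem trialLaw_true (μ : Bool → PMF (List (StackSymbol A))) (b : Bool) :
    (trialLaw μ (b, true)).toReal = (((μ b).bind acceptLaw) true).toReal / 2 := by
  have h (c : Bool) (p : PMF Bool) : (p.map fun r => (c, r)) (b, true) =
      if b = c then p true else 0 := by
    rw [PMF.map_apply, tsum_bool]
    cases b <;> cases c <;> simp
  rw [trialLaw, PMF.toReal_uniform_bind, h, h]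
  cases b <;> simp <;> ring

theorem trialLaw_error_le (μ : Bool → PMF (List (StackSymbol A))) {v : Bool → ℝ} {ε δ : ℝ}
    (hv0 : ∀ b, 0 ≤ v b) (hv1 : ∀ b, v b ≤ 1) (hε : 0 ≤ ε) (hδ : 0 ≤ δ)
    (h : ∀ b, (μ b).toOuterMeasure {w | ε ≤ |v b - estimateValue w|} ≤ ENNReal.ofReal δ)
    (b : Bool) : |(trialLaw μ (b, true)).toReal - v b / 4| ≤ ε + δ := by
  have := abs_bind_acceptLaw_sub_le (μ b) (hv0 b) (hv1 b) hε hδ (h b)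
  rw [trialLaw_true]
  rw [abs_le] at *
  constructor <;> linarith

end Accept

/-! ## A library of programs -/

section Library

variable {A : Type*}

theorem Exec.append_map {ι : Type*} {l l' : List (Prog A)} {s : Stacks A} {T T' : ℕ} {μ : PMF ι}
    {g : ι → Stacks A} {F : ι → PMF (Stacks A)} (h : Exec l s T (μ.map g))
    (h' : ∀ i ∈ μ.support, Exec l' (g i) T' (F i)) : Exec (l ++ l') s (T + T') (μ.bind F) := by
  have e : (μ.map g).bind (fun s' => (Cfg.run T' ⟨l', s'⟩).map Cfg.stk) = μ.bind F := by
    rw [PMF.bind_map]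
    exact PMF.bind_congr_support fun i hi => (h' i hi).eq_map_stk.symm
  rw [← e]
  refine h.append fun s' hs' => ?_
  obtain ⟨i, hi, rfl⟩ := (PMF.mem_support_map_iff _ _ _).1 hs'
  exact exec_of_halts (h' i hi).halts

theorem Exec.seq_map {ι : Type*} {p q : Prog A} {s : Stacks A} {T T' : ℕ} {μ : PMF ι}
    {g : ι → Stacks A} {F : ι → PMF (Stacks A)} (h : Exec [p] s T (μ.map g))
    (h' : ∀ i ∈ μ.support, Exec [q] (g i) T' (F i)) : Exec [.seq p q] s (T + T' + 1) (μ.bind F) :=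
  exec_of_step rfl (h.append_map h')

theorem exec_loop_map {ι : Type*} {r : ℕ} {test : Option (StackSymbol A) → Bool} {p : Prog A}
    {s : Stacks A} {T T' : ℕ} {μ : PMF ι} {g : ι → Stacks A} {F : ι → PMF (Stacks A)}
    (ht : test (s r).head? = true) (h : Exec [p] s T (μ.map g))
    (h' : ∀ i ∈ μ.support, Exec [.loop r test p] (g i) T' (F i)) :
    Exec [.loop r test p] s (T + T' + 1) (μ.bind F) :=
  exec_of_step (by simp [Cfg.step, ht]) (h.append_map h')

theorem Exec.of_eq {l : List (Prog A)} {s s' : Stacks A} {T T' : ℕ} {D D' : PMF (Stacks A)}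
    (h : Exec l s' T' D') (hs : s = s') (hT : T' ≤ T) (hD : D = D') : Exec l s T D := by
  subst hs hD
  exact h.mono hT

/-- Empty the stack `r`. -/
def clear (r : ℕ) : Prog A := .loop r Option.isSome (.pop r)

theorem exec_clear (r : ℕ) (s : Stacks A) :
    Exec [clear r] s (2 * (s r).length + 1) (PMF.pure (Function.update s r [])) := by
  generalize hw : s r = w
  induction w generalizing s with
  | nil =>
    refine (exec_loop_false (by simp [hw])).of_eq rfl (by simp) ?_
    rw [← hw, Function.update_eq_self]
  | cons x w ih =>
    have := exec_loop_pure (r := r) (test := Option.isSome) (by simp [hw]) (exec_pop r s)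
      (ih _ (by simp [hw]))
    exact this.of_eq rfl (by simp; omega) (by simp)

/-- Empty all stacks below `R`. -/
def clearBelow : ℕ → Prog A
  | 0 => .skip
  | R + 1 => .seq (clearBelow R) (clear R)

theorem exec_clearBelow {R B : ℕ} {s : Stacks A} (h : ∀ r < R, (s r).length ≤ B) :
    Exec [clearBelow R] s (R * (2 * B + 2) + 1)
      (PMF.pure fun r => if r < R then [] else s r) := by
  induction R with
  | zero => exact (exec_skip s).of_eq rfl (by omega) (by simp)
  | succ R ih =>
    refine ((ih fun r hr => h r (by omega)).pure_seq (exec_clear R _)).of_eq rfl ?_ ?_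
    · have := h R (by omega)
      simp only [lt_irrefl, if_false]
      nlinarith
    · congr 1
      funext r
      rcases eq_or_ne r R with rfl | hr
      · simp
      · have : r < R + 1 ↔ r < R := by omega
        simp [hr, this]

theorem exec_clearBelow_mem {R B : ℕ} {low : Stacks A} (hi : List (List (StackSymbol A)))
    (h : ∀ r < R, (low r).length ≤ B) :
    Exec [clearBelow R] (mem R low hi) (R * (2 * B + 2) + 1)
      (PMF.pure (mem R (fun _ => []) hi)) := by
  refine (exec_clearBelow fun r hr => ?_).of_eq rfl le_rfl ?_
  · rw [mem_of_lt hr]; exact h r hr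
  · congr 1
    funext r
    by_cases hr : r < R <;> simp [mem, hr]

/-- Branch on the top symbol of stack `r`, given a list of the symbols that may occur. -/
noncomputable def dispatch (r : ℕ) (body : StackSymbol A → Prog A) :
    List (StackSymbol A) → Prog A
  | [] => .skip
  | x :: L => .ite r (fun o => open Classical in decide (o = some x)) (body x) (dispatch r body L)

theorem exec_dispatch {r : ℕ} {body : StackSymbol A → Prog A} {L : List (StackSymbol A)}
    {s : Stacks A} {x : StackSymbol A} {T : ℕ} {D : PMF (Stacks A)} (hx : x ∈ L)
    (hs : (s r).head? = some x) (h : Exec [body x] s T D) :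
    Exec [dispatch r body L] s (T + L.length) D := by
  induction L with
  | nil => simp at hx
  | cons y L ih =>
    by_cases hy : x = y
    · subst hy
      exact (exec_ite_true (by simp [hs]) h).mono (by simp)
    · exact (exec_ite_false (by simp [hs, hy]) (ih (by simpa [hy] using hx))).mono
        (by simp [Nat.add_assoc])

/-- A list of all stack symbols. -/
noncomputable def symbols (A : Type*) [Fintype A] : List (StackSymbol A) :=
  .wild :: .bit true :: .bit false :: Finset.univ.toList.map .letter

theorem mem_symbols [Fintype A] (x : StackSymbol A) : x ∈ symbols A := by
  rcases x with a | (_ | _) | _ <;> simp [symbols]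

/-- The first stacks have the listed contents, the others are empty. -/
def fill (L : List (List (StackSymbol A))) : Stacks A := fun r => L.getD r []

theorem update_fill {L : List (List (StackSymbol A))} {r : ℕ} (hr : r < L.length)
    (x : List (StackSymbol A)) : Function.update (fill L) r x = fill (L.set r x) := by
  have h (L : List (List (StackSymbol A))) : fill L = mem 0 (fun _ => []) L := by
    funext q
    simp [mem, fill]
  rw [h, h, ← update_mem_add _ _ hr, Nat.zero_add]

variable [Fintype A]

/-- Move the content of `src`, reversed, onto `dst`. -/
noncomputable def shift (src dst : ℕ) : Prog A :=
  .loop src Option.isSome (dispatch src (fun x => .seq (.pop src) (.push dst x)) (symbols A))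

theorem exec_shift {src dst : ℕ} (hne : src ≠ dst) (s : Stacks A) :
    Exec [shift src dst] s (((symbols A).length + 4) * (s src).length + 1)
      (PMF.pure (Function.update (Function.update s src []) dst ((s src).reverse ++ s dst))) := by
  generalize hw : s src = w
  induction w generalizing s with
  | nil =>
    refine (exec_loop_false (by simp [hw])).of_eq rfl (by simp) ?_
    rw [← hw, Function.update_eq_self, hw]
    simp
  | cons x w ih =>
    have hbody := exec_dispatch (s := s) (r := src) (mem_symbols x) (by simp [hw])
      (body := fun x => .seq (.pop src) (.push dst x))
      ((exec_pop src s).pure_seq (exec_push dst x _))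
    refine (exec_loop_pure (by simp [hw]) hbody (ih _ (by simp [hw, hne]))).of_eq rfl ?_ ?_
    · simp only [List.length_cons]
      ring_nf
      omega
    · congr 1
      funext r
      rcases eq_or_ne r dst with rfl | h1
      · simp [hne.symm]
      · rcases eq_or_ne r src with rfl | h2 <;> simp [*]

/-- Move the content of `src`, reversed, onto both `dst` and `dst'`. -/
noncomputable def fork (src dst dst' : ℕ) : Prog A :=
  .loop src Option.isSome (dispatch src
    (fun x => .seq (.pop src) (.seq (.push dst x) (.push dst' x))) (symbols A))

theorem exec_fork {src dst dst' : ℕ} (h1 : src ≠ dst) (h2 : src ≠ dst') (h3 : dst ≠ dst')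
    (s : Stacks A) :
    Exec [fork src dst dst'] s (((symbols A).length + 6) * (s src).length + 1)
      (PMF.pure (Function.update (Function.update (Function.update s src [])
        dst ((s src).reverse ++ s dst)) dst' ((s src).reverse ++ s dst'))) := by
  generalize hw : s src = w
  induction w generalizing s with
  | nil =>
    refine (exec_loop_false (by simp [hw])).of_eq rfl (by simp) ?_
    rw [← hw, Function.update_eq_self, hw]
    simp
  | cons x w ih =>
    have hbody := exec_dispatch (s := s) (r := src) (mem_symbols x) (by simp [hw])
      (body := fun x => .seq (.pop src) (.seq (.push dst x) (.push dst' x)))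
      ((exec_pop src s).pure_seq ((exec_push dst x _).pure_seq (exec_push dst' x _)))
    refine (exec_loop_pure (by simp [hw]) hbody (ih _ (by simp [hw, h1, h2]))).of_eq rfl ?_ ?_
    · simp only [List.length_cons]
      ring_nf
      omega
    · congr 1
      funext r
      rcases eq_or_ne r dst' with rfl | h4
      · simp [h2.symm, h3.symm]
      · rcases eq_or_ne r dst with rfl | h5
        · simp [h1.symm, h3]
        · rcases eq_or_ne r src with rfl | h6 <;> simp [*]

/-- Put a copy of the content of `src` on top of `dst`, by means of the empty stack `tmp`. -/
noncomputable def copy (src dst tmp : ℕ) : Prog A := .seq (shift src tmp) (fork tmp src dst)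

/-- A bound for the running time of `copy` on a stack of height at most `B`. -/
noncomputable def copyTime (A : Type*) [Fintype A] (B : ℕ) : ℕ :=
  (2 * (symbols A).length + 10) * B + 3

theorem exec_copy {src dst tmp B : ℕ} (h1 : src ≠ dst) (h2 : src ≠ tmp) (h3 : dst ≠ tmp)
    {s : Stacks A} (ht : s tmp = []) (hB : (s src).length ≤ B) :
    Exec [copy src dst tmp] s (copyTime A B)
      (PMF.pure (Function.update s dst (s src ++ s dst))) := by
  refine ((exec_shift h2 s).pure_seq (exec_fork h2.symm h3.symm h1 _)).of_eq rfl ?_ ?_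
  · simp only [Function.update_self, List.length_append, List.length_reverse, ht, List.length_nil,
      copyTime]
    have := Nat.mul_le_mul_left (2 * (symbols A).length + 10) hB
    nlinarith
  · congr 1
    funext r
    rcases eq_or_ne r dst with rfl | h4
    · simp [h1.symm, h3, ht]
    · rcases eq_or_ne r src with rfl | h5
      · simp [h1, h2, ht]
      · rcases eq_or_ne r tmp with rfl | h6 <;> simp [*]

theorem exec_copy_low {R i r B : ℕ} (hr : r < R) {L hi : List (List (StackSymbol A))}
    (hL : r < L.length) (hi5 : i ≠ 5) (ht : hi.getD 5 [] = [])
    (hB : (hi.getD i []).length ≤ B) :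
    Exec [copy (R + i) r (R + 5)] (mem R (fill L) hi) (copyTime A B)
      (PMF.pure (mem R (fill (L.set r (hi.getD i [] ++ L.getD r []))) hi)) := by
  refine (exec_copy (by omega) (by omega) (by omega) (by simpa using ht) (by simpa using hB)).of_eq
    rfl le_rfl ?_
  rw [update_mem_of_lt hr, update_fill hL, mem_add, mem_of_lt hr]
  rfl

theorem exec_copy_high {R i j B : ℕ} {low : Stacks A} {hi : List (List (StackSymbol A))}
    (hj : j < hi.length) (hij : i ≠ j) (hi5 : i ≠ 5) (hj5 : j ≠ 5) (ht : hi.getD 5 [] = [])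
    (hB : (hi.getD i []).length ≤ B) :
    Exec [copy (R + i) (R + j) (R + 5)] (mem R low hi) (copyTime A B)
      (PMF.pure (mem R low (hi.set j (hi.getD i [] ++ hi.getD j [])))) := by
  refine (exec_copy (by omega) (by omega) (by omega) (by simpa using ht) (by simpa using hB)).of_eq
    rfl le_rfl ?_
  rw [update_mem_add _ _ hj, mem_add, mem_add]

end Library

section Accept

variable {A : Type*}

/-- The loop body of `accept`. -/
noncomputable def acceptBody (N : ℕ) : Prog A :=
  .seq (.flip 0) (.ite 0 (fun o => open Classical in decide (o = some (.bit true)))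
    (.seq (.pop 0) (.seq (.ite 0 (fun o => open Classical in decide (o = some (.bit true)))
      (clear N) .skip) (clear 0)))
    (.seq (.pop 0) (.pop 0)))

/-- Consume the estimate on stack `0`, and empty stack `N` if the coin flips decide to accept. -/
noncomputable def accept (N : ℕ) : Prog A := .loop 0 Option.isSome (acceptBody N)

open Classical in
theorem exec_acceptBody {N B : ℕ} (hN : N ≠ 0) {s : Stacks A} {x : StackSymbol A}
    {w : List (StackSymbol A)} (hs : s 0 = x :: w) (hB : w.length ≤ B) :
    Exec [acceptBody N] s (2 * (s N).length + 2 * B + 12)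
      ((PMF.uniformOfFintype Bool).map fun c : Bool =>
        Function.update (Function.update s 0 (if c then [] else w)) N
          (if c ∧ x = .bit true then [] else s N)) := by
  have h := (exec_flip 0 s).seq_map (T' := 2 * (s N).length + 2 * B + 10)
    (q := .ite 0 (fun o => open Classical in decide (o = some (.bit true)))
      (.seq (.pop 0) (.seq (.ite 0 (fun o => open Classical in decide (o = some (.bit true)))
        (clear N) .skip) (clear 0)))
      (.seq (.pop 0) (.pop 0)))
    (F := fun c : Bool => PMF.pure (Function.update (Function.update s 0 (if c then [] else w)) N
          (if c ∧ x = .bit true then [] else s N))) ?_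
  · exact h.of_eq rfl (by omega) rfl
  rintro (_ | _) -
  · refine (exec_ite_false (by simp) ((exec_pop 0 _).pure_seq (exec_pop 0 _))).of_eq rfl
      (by omega) ?_
    simp [hs, Function.update_comm hN.symm]
  · by_cases hx : x = .bit true
    · refine (exec_ite_true (by simp) ((exec_pop 0 _).pure_seq
        ((exec_ite_true (by simp [hs, hx]) (exec_clear N _)).pure_seq (exec_clear 0 _)))).of_eq rfl
        ?_ ?_
      · simp [hs, hN, hN.symm]
        omega
      · simp [hx, Function.update_comm hN]
    · refine (exec_ite_true (by simp) ((exec_pop 0 _).pure_seq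
        ((exec_ite_false (by simp [hs, hx]) (exec_skip _)).pure_seq (exec_clear 0 _)))).of_eq rfl
        ?_ ?_
      · simp [hs]
        omega
      · simp [hx, Function.update_comm hN.symm]

open Classical in
theorem exec_accept {N B : ℕ} (hN : N ≠ 0) {s : Stacks A} (hB : (s 0).length ≤ B) :
    Exec [accept N] s ((s 0).length * (2 * (s N).length + 2 * B + 14) + 1)
      ((acceptLaw (s 0)).map fun r =>
        Function.update (Function.update s 0 []) N (if r then [] else s N)) := by
  generalize hw : s 0 = w at *
  induction w generalizing s with
  | nil =>
    refine (exec_loop_false (by simp [hw])).of_eq rfl (by omega) ?_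
    rw [← hw, Function.update_eq_self, hw, acceptLaw, PMF.pure_map]
    simp
  | cons x w ih =>
    rw [List.length_cons] at hB
    have h := exec_loop_map (r := 0) (test := Option.isSome)
      (T' := w.length * (2 * (s N).length + 2 * B + 14) + 1) (by simp [hw])
      (exec_acceptBody (B := B) hN hw (by omega))
      (F := fun c : Bool => if c then PMF.pure (Function.update (Function.update s 0 []) N
          (if x = .bit true then [] else s N)) else (acceptLaw w).map fun r =>
        Function.update (Function.update s 0 []) N (if r then [] else s N)) ?_
    · refine h.of_eq rfl (by simp only [List.length_cons]; ring_nf; omega) ?_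
      rw [acceptLaw, PMF.map_bind]
      refine congrArg _ (funext fun c => ?_)
      cases c <;> simp [PMF.pure_map]
    rintro (_ | _) -
    · refine (ih (s := Function.update (Function.update s 0 w) N (s N)) ?_ ?_).of_eq ?_ ?_ ?_
      · simp [hN.symm]
      · omega
      · simp
      · simp
      · simp [Function.update_comm hN]
    · refine (exec_loop_false (s := Function.update (Function.update s 0 []) N
        (if x = .bit true then [] else s N)) (by simp [hN.symm])).of_eq (by simp) (by omega)
        (by simp)

end Accept

/-! ## The simulator -/

section Simulator

variable {A : Type*}

theorem exec_push_high {R i : ℕ} {low : Stacks A} {hi : List (List (StackSymbol A))}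
    (h : i < hi.length) (x : StackSymbol A) :
    Exec [.push (R + i) x] (mem R low hi) 1
      (PMF.pure (mem R low (hi.set i (x :: hi.getD i [])))) := by
  rw [← update_mem_add _ _ h, ← mem_add R i low hi]
  exact exec_push _ _ _

theorem exec_pop_high {R i : ℕ} {low : Stacks A} {hi : List (List (StackSymbol A))}
    (h : i < hi.length) :
    Exec [.pop (R + i)] (mem R low hi) 1
      (PMF.pure (mem R low (hi.set i (hi.getD i []).tail))) := by
  rw [← update_mem_add _ _ h, ← mem_add R i low hi]
  exact exec_pop _ _

theorem exec_flip_high {R i : ℕ} {low : Stacks A} {hi : List (List (StackSymbol A))}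
    (h : i < hi.length) :
    Exec [.flip (R + i)] (mem R low hi) 1 ((PMF.uniformOfFintype Bool).map fun b =>
      mem R low (hi.set i (.bit b :: hi.getD i []))) := by
  simp only [← update_mem_add _ _ h, ← mem_add R i low hi]
  exact exec_flip _ _

/-- Push `n` ones on stack `r`. -/
def pushOnes (r : ℕ) : ℕ → Prog A
  | 0 => .skip
  | n + 1 => .seq (pushOnes r n) (.push r (.bit true))

theorem exec_pushOnes {R : ℕ} {low : Stacks A} {a g w d n t y : List (StackSymbol A)} (i j : ℕ) :
    Exec [pushOnes (R + 6) i] (mem R low [a, g, w, d, n, t, encodeUnary j, y]) (2 * i + 1)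
      (PMF.pure (mem R low [a, g, w, d, n, t, encodeUnary (i + j), y])) := by
  induction i with
  | zero => exact (exec_skip _).of_eq rfl (by omega) (by simp)
  | succ i ih =>
    refine (ih.pure_seq (exec_push_high (by simp) _)).of_eq rfl (by omega) ?_
    rw [Nat.succ_add]
    rfl

/-- Turn the number of outcome bits on stack `0` into wild cards on stack `R + 2` and ones on stack
`R + 6`. -/
noncomputable def unpack (R : ℕ) : Prog A :=
  .loop 0 Option.isSome (.seq (.pop 0) (.seq (.push (R + 2) .wild) (.push (R + 6) (.bit true))))

theorem exec_unpack {R k : ℕ} (hR : 0 < R) {s : Stacks A} (hs : s 0 = encodeUnary k)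
    {a g d n t y : List (StackSymbol A)} (i j : ℕ) :
    Exec [unpack R]
      (mem R s [a, g, List.replicate i .wild, d, n, t, encodeUnary j, y]) (k * 6 + 1)
      (PMF.pure (mem R (Function.update s 0 [])
        [a, g, List.replicate (k + i) .wild, d, n, t, encodeUnary (k + j), y])) := by
  induction k generalizing s i j with
  | zero =>
    have e : s 0 = [] := hs
    refine (exec_loop_false (by simp [mem, hR, e])).of_eq rfl (by simp) ?_
    rw [← e, Function.update_eq_self, Nat.zero_add, Nat.zero_add]
  | succ k ih =>
    have h0 : mem R s [a, g, List.replicate i .wild, d, n, t, encodeUnary j, y] 0 =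
      .bit true :: encodeUnary k := by rw [mem_of_lt hR, hs]; rfl
    have h1 : Exec [.pop 0] (mem R s [a, g, List.replicate i .wild, d, n, t, encodeUnary j, y]) 1
        (PMF.pure (mem R (Function.update s 0 (encodeUnary k))
          [a, g, List.replicate i .wild, d, n, t, encodeUnary j, y])) := by
      have := exec_pop 0 (mem R s [a, g, List.replicate i .wild, d, n, t, encodeUnary j, y])
      rwa [update_mem_of_lt hR, h0] at this
    refine (exec_loop_pure (by rw [h0]; rfl)
      (h1.pure_seq ((exec_push_high (by simp) _).pure_seq (exec_push_high (by simp) _)))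
      (ih (s := Function.update s 0 (encodeUnary k)) (by simp) (i + 1) (j + 1))).of_eq rfl
      (by omega) ?_
    rw [Function.update_idem, Nat.succ_add, Nat.succ_add]
    rfl

theorem fill_nil : (fun _ => [] : Stacks A) = fill [[], [], [], []] := by
  funext r
  rcases r with _ | _ | _ | _ | r <;> rfl

/-- A bound for the running time of `accept` and the subsequent cleaning. -/
def cleanTime (R B L : ℕ) : ℕ := L * (2 * B + 2 * L + 14) + R * (2 * L + 2) + 3

theorem exec_accept_clean {R B L : ℕ} (hR : 0 < R) {s : Stacks A} {a g w d n : List (StackSymbol A)}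
    (hs : ∀ r < R, (s r).length ≤ L) (hn : n.length ≤ B) :
    Exec [.seq (accept (R + 4)) (clearBelow R)] (mem R s [a, g, w, d, n, [], [], []])
      (cleanTime R B L) ((acceptLaw (s 0)).map fun r =>
        mem R (fun _ => []) [a, g, w, d, if r then [] else n, [], [], []]) := by
  have h0 : mem R s [a, g, w, d, n, [], [], []] 0 = s 0 := mem_of_lt hR _ _
  have h1 := exec_accept (N := R + 4) (B := L) (by omega)
    (s := mem R s [a, g, w, d, n, [], [], []]) (by rw [h0]; exact hs 0 hR)
  rw [h0] at h1
  have h2 := h1.seq_map (q := clearBelow R) (T' := R * (2 * L + 2) + 1)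
    (F := fun r => PMF.pure
      (mem R (fun _ => []) [a, g, w, d, if r then [] else n, [], [], []])) ?_
  · refine h2.of_eq rfl ?_ rfl
    have e : (mem R s [a, g, w, d, n, [], [], []] (R + 4)) = n := by simp
    rw [e]
    have := Nat.mul_le_mul (hs 0 hR)
      (Nat.add_le_add_right (Nat.add_le_add_right (Nat.mul_le_mul_left 2 hn) (2 * L)) 14)
    rw [cleanTime]
    omega
  · intro r _
    rw [update_mem_of_lt hR, update_mem_add _ _ (by simp)]
    refine (exec_clearBelow_mem (B := L) _ fun r hr => ?_).of_eq rfl le_rfl ?_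
    · rcases eq_or_ne r 0 with rfl | h
      · simp
      · simpa [h] using hs r hr
    · simp

variable [Fintype A]

/-- One trial: propose a random next bit, call the poly-box `M` on the corresponding event, and
empty the counter on stack `R + 4` if the proposal is accepted. -/
noncomputable def trial (M : Prog A) (R : ℕ) : Prog A :=
  .seq (.pop (R + 4)) <| .seq (.pop (R + 3)) <| .seq (.flip (R + 3)) <|
  .seq (copy (R + 0) 0 (R + 5)) <| .seq (copy (R + 1) 1 (R + 5)) <|
  .seq (copy (R + 1) 2 (R + 5)) <| .seq (copy (R + 3) 3 (R + 5)) <|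
  .seq (copy (R + 2) 3 (R + 5)) <| .seq M <| .seq (accept (R + 4)) (clearBelow R)

/-- A bound for the running time of `trial`. -/
noncomputable def trialTime (A : Type*) [Fintype A] (R B T : ℕ) : ℕ :=
  5 * copyTime A B + T + cleanTime R B (B + T) + 12

theorem exec_trial {M : Prog A} {R B T : ℕ} (hM : M.UsesBelow R) (hR : 4 ≤ R)
    {a g w d n : List (StackSymbol A)} {c x : StackSymbol A}
    {μ : Bool → PMF (List (StackSymbol A))}
    (hμ : ∀ b, ∃ E, Exec [M] (fill [a, g, g, w ++ .bit b :: d]) T E ∧ μ b = E.map fun s => s 0)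
    (ha : a.length ≤ B) (hg : g.length ≤ B) (hw : w.length + d.length + 1 ≤ B)
    (hn : n.length ≤ B) :
    Exec [trial M R] (mem R (fun _ => []) [a, g, w, c :: d, x :: n, [], [], []])
      (trialTime A R B T) ((trialLaw μ).map fun r =>
        mem R (fun _ => []) [a, g, w, .bit r.1 :: d, if r.2 then [] else n, [], [], []]) := by
  have step (b : Bool) : Exec [.seq M (.seq (accept (R + 4)) (clearBelow R))]
      (mem R (fill [a, g, g, w ++ .bit b :: d]) [a, g, w, .bit b :: d, n, [], [], []])
      (T + cleanTime R B (B + T) + 1) (((μ b).bind acceptLaw).map fun r =>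
        mem R (fun _ => []) [a, g, w, .bit b :: d, if r then [] else n, [], [], []]) := by
    obtain ⟨E, hE, hμE⟩ := hμ b
    refine ((hE.mem hM _).seq_map fun s hs => exec_accept_clean (by omega) (fun r hr => ?_)
      hn).of_eq rfl le_rfl ?_
    · refine (hE.length_le hs r).trans (Nat.add_le_add_right ?_ T)
      rcases r with _ | _ | _ | _ | r <;> simp [fill] <;> omega
    · rw [hμE, PMF.bind_map, PMF.map_bind]
      rfl
  have h1 : Exec [.pop (R + 4)] (mem R (fun _ => []) [a, g, w, c :: d, x :: n, [], [], []]) 1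
      (PMF.pure (mem R (fun _ => []) [a, g, w, c :: d, n, [], [], []])) :=
    exec_pop_high (by simp)
  have h2 : Exec [.pop (R + 3)] (mem R (fun _ => []) [a, g, w, c :: d, n, [], [], []]) 1
      (PMF.pure (mem R (fun _ => []) [a, g, w, d, n, [], [], []])) :=
    exec_pop_high (by simp)
  have h3 : Exec [.flip (R + 3)] (mem R (fun _ => []) [a, g, w, d, n, [], [], []]) 1
      ((PMF.uniformOfFintype Bool).map fun b =>
        mem R (fill [[], [], [], []]) [a, g, w, .bit b :: d, n, [], [], []]) := by
    rw [← fill_nil]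
    exact exec_flip_high (by simp)
  have h4 (b : Bool) : Exec [copy (R + 0) 0 (R + 5)]
      (mem R (fill [[], [], [], []]) [a, g, w, .bit b :: d, n, [], [], []]) (copyTime A B)
      (PMF.pure (mem R (fill [a, [], [], []]) [a, g, w, .bit b :: d, n, [], [], []])) := by
    simpa using exec_copy_low (R := R) (i := 0) (r := 0) (L := [[], [], [], []])
      (hi := [a, g, w, .bit b :: d, n, [], [], []]) (by omega) (by simp) (by simp) rfl ha
  have h5 (b : Bool) : Exec [copy (R + 1) 1 (R + 5)]
      (mem R (fill [a, [], [], []]) [a, g, w, .bit b :: d, n, [], [], []]) (copyTime A B)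
      (PMF.pure (mem R (fill [a, g, [], []]) [a, g, w, .bit b :: d, n, [], [], []])) := by
    simpa using exec_copy_low (R := R) (i := 1) (r := 1) (L := [a, [], [], []])
      (hi := [a, g, w, .bit b :: d, n, [], [], []]) (by omega) (by simp) (by simp) rfl hg
  have h6 (b : Bool) : Exec [copy (R + 1) 2 (R + 5)]
      (mem R (fill [a, g, [], []]) [a, g, w, .bit b :: d, n, [], [], []]) (copyTime A B)
      (PMF.pure (mem R (fill [a, g, g, []]) [a, g, w, .bit b :: d, n, [], [], []])) := by
    simpa using exec_copy_low (R := R) (i := 1) (r := 2) (L := [a, g, [], []])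
      (hi := [a, g, w, .bit b :: d, n, [], [], []]) (by omega) (by simp) (by simp) rfl hg
  have h7 (b : Bool) : Exec [copy (R + 3) 3 (R + 5)]
      (mem R (fill [a, g, g, []]) [a, g, w, .bit b :: d, n, [], [], []]) (copyTime A B)
      (PMF.pure (mem R (fill [a, g, g, .bit b :: d]) [a, g, w, .bit b :: d, n, [], [], []])) := by
    simpa using exec_copy_low (R := R) (i := 3) (r := 3) (L := [a, g, g, []]) (B := B)
      (hi := [a, g, w, .bit b :: d, n, [], [], []]) (by omega) (by simp) (by simp) rfl
      (by simp; omega)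
  have h8 (b : Bool) : Exec [copy (R + 2) 3 (R + 5)]
      (mem R (fill [a, g, g, .bit b :: d]) [a, g, w, .bit b :: d, n, [], [], []]) (copyTime A B)
      (PMF.pure (mem R (fill [a, g, g, w ++ .bit b :: d])
        [a, g, w, .bit b :: d, n, [], [], []])) := by
    simpa using exec_copy_low (R := R) (i := 2) (r := 3) (L := [a, g, g, .bit b :: d]) (B := B)
      (hi := [a, g, w, .bit b :: d, n, [], [], []]) (by omega) (by simp) (by simp) rfl
      (by simp; omega)
  refine (h1.pure_seq (h2.pure_seq (h3.seq_map fun b _ => (h4 b).pure_seq ((h5 b).pure_seq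
    ((h6 b).pure_seq ((h7 b).pure_seq ((h8 b).pure_seq (step b)))))))).of_eq rfl ?_ ?_
  · rw [trialTime]; omega
  · rw [trialLaw, PMF.map_bind]
    simp only [PMF.map_comp]
    rfl

theorem exec_trials {M : Prog A} {R B T : ℕ} (hM : M.UsesBelow R) (hR : 4 ≤ R)
    {a g w d n : List (StackSymbol A)} {μ : Bool → PMF (List (StackSymbol A))}
    (hμ : ∀ b, ∃ E, Exec [M] (fill [a, g, g, w ++ .bit b :: d]) T E ∧ μ b = E.map fun s => s 0)
    (ha : a.length ≤ B) (hg : g.length ≤ B) (hw : w.length + d.length + 1 ≤ B)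
    (hn : n.length ≤ B) (c : Bool) :
    Exec [.loop (R + 4) Option.isSome (trial M R)]
      (mem R (fun _ => []) [a, g, w, .bit c :: d, n, [], [], []])
      (n.length * (trialTime A R B T + 1) + 1)
      ((rejectionLaw (trialLaw μ) n.length c).map fun b =>
        mem R (fun _ => []) [a, g, w, .bit b :: d, [], [], [], []]) := by
  induction n generalizing c with
  | nil =>
    refine (exec_loop_false (by simp)).of_eq rfl (by simp) ?_
    rw [List.length_nil, rejectionLaw, PMF.pure_map]
  | cons x n ih =>
    have hn' : n.length ≤ B := by simp at hn; omega
    refine (exec_loop_map (T' := n.length * (trialTime A R B T + 1) + 1) (by simp)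
      (exec_trial hM hR hμ ha hg hw hn')
      (F := fun r => (if r.2 then PMF.pure r.1 else
        rejectionLaw (trialLaw μ) n.length r.1).map fun b =>
          mem R (fun _ => []) [a, g, w, .bit b :: d, [], [], [], []]) ?_).of_eq rfl ?_ ?_
    · rintro ⟨b, _ | _⟩ -
      · exact ih hn' b
      · refine (exec_loop_false (by simp)).of_eq rfl (by omega) ?_
        simp [PMF.pure_map]
    · simp only [List.length_cons]
      ring_nf
      omega
    · rw [List.length_cons, rejectionLaw, PMF.map_bind]

/-- Draw one more bit. -/
noncomputable def drawBit (M : Prog A) (R : ℕ) : Prog A :=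
  .seq (.pop (R + 2)) <| .seq (.push (R + 3) (.bit true)) <|
  .seq (copy (R + 1) (R + 4) (R + 5)) (.loop (R + 4) Option.isSome (trial M R))

/-- A bound for the running time of `drawBit`. -/
noncomputable def drawTime (A : Type*) [Fintype A] (R B T : ℕ) : ℕ :=
  copyTime A B + B * (trialTime A R B T + 1) + 6

theorem exec_drawBit {M : Prog A} {R B T : ℕ} (hM : M.UsesBelow R) (hR : 4 ≤ R)
    {a g w d : List (StackSymbol A)} {x : StackSymbol A} {μ : Bool → PMF (List (StackSymbol A))}
    (hμ : ∀ b, ∃ E, Exec [M] (fill [a, g, g, w ++ .bit b :: d]) T E ∧ μ b = E.map fun s => s 0)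
    (ha : a.length ≤ B) (hg : g.length ≤ B) (hw : w.length + d.length + 1 ≤ B) :
    Exec [drawBit M R] (mem R (fun _ => []) [a, g, x :: w, d, [], [], [], []])
      (drawTime A R B T) ((rejectionLaw (trialLaw μ) g.length true).map fun b =>
        mem R (fun _ => []) [a, g, w, .bit b :: d, [], [], [], []]) := by
  have h1 : Exec [.pop (R + 2)] (mem R (fun _ => []) [a, g, x :: w, d, [], [], [], []]) 1
      (PMF.pure (mem R (fun _ => []) [a, g, w, d, [], [], [], []])) := exec_pop_high (by simp)
  have h2 : Exec [.push (R + 3) (.bit true)] (mem R (fun _ => []) [a, g, w, d, [], [], [], []]) 1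
      (PMF.pure (mem R (fun _ => []) [a, g, w, .bit true :: d, [], [], [], []])) :=
    exec_push_high (by simp) _
  have h3 : Exec [copy (R + 1) (R + 4) (R + 5)]
      (mem R (fun _ => []) [a, g, w, .bit true :: d, [], [], [], []]) (copyTime A B)
      (PMF.pure (mem R (fun _ => []) [a, g, w, .bit true :: d, g, [], [], []])) := by
    simpa using exec_copy_high (R := R) (i := 1) (j := 4) (low := fun _ => [])
      (hi := [a, g, w, .bit true :: d, [], [], [], []]) (by simp) (by simp) (by simp) (by simp)
      rfl hg
  refine (h1.pure_seq (h2.pure_seq (h3.pure_seq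
    (exec_trials hM hR hμ ha hg hw hg true)))).of_eq rfl ?_ rfl
  have := Nat.mul_le_mul_right (trialTime A R B T + 1) hg
  rw [drawTime]
  omega

theorem exec_drawBits {M : Prog A} {R B T k : ℕ} (hM : M.UsesBelow R) (hR : 4 ≤ R)
    {a g : List (StackSymbol A)} {μ : List Bool → Bool → PMF (List (StackSymbol A))}
    (hμ : ∀ D b, D.length < k → ∃ E, Exec [M] (fill [a, g, g,
      List.replicate (k - D.length - 1) .wild ++ (b :: D).map .bit]) T E ∧
        μ D b = E.map fun s => s 0)
    (ha : a.length ≤ B) (hg : g.length ≤ B) (hk : k ≤ B) {i : ℕ} {D : List Bool}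
    (hi : i + D.length = k) :
    Exec [.loop (R + 2) Option.isSome (drawBit M R)]
      (mem R (fun _ => []) [a, g, List.replicate i .wild, D.map .bit, [], [], [], []])
      (i * (drawTime A R B T + 1) + 1)
      ((extendLaw (fun D => rejectionLaw (trialLaw (μ D)) g.length true) i D).map fun D =>
        mem R (fun _ => []) [a, g, [], D.map .bit, [], [], [], []]) := by
  induction i generalizing D with
  | zero =>
    refine (exec_loop_false (by simp)).of_eq rfl (by simp) ?_
    rw [extendLaw, PMF.pure_map]
    rfl
  | succ i ih =>
    have hk' : k - D.length - 1 = i := by omega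
    refine (exec_loop_map (T' := i * (drawTime A R B T + 1) + 1) (by simp)
      (exec_drawBit (x := .wild) (w := List.replicate i .wild) (d := D.map .bit) (B := B)
        (T := T) (μ := μ D) hM hR
        (fun b => ?_) ha hg ?_)
      (fun b _ => ih (D := b :: D) (by simp; omega))).of_eq rfl ?_ ?_
    · have := hμ D b (by omega)
      rwa [hk'] at this
    · simp; omega
    · ring_nf
      omega
    · rw [extendLaw, PMF.map_bind]

/-! ### Preparation -/

/-- Multiply the number on stack `R + 1` by the number on stack `R + 6`. -/
noncomputable def multiply (R : ℕ) : Prog A :=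
  .seq (.loop (R + 1) Option.isSome (.seq (.pop (R + 1)) (copy (R + 6) (R + 7) (R + 5))))
    (shift (R + 7) (R + 1))

theorem exec_multiply {R : ℕ} {low : Stacks A} {a w d n : List (StackSymbol A)} (i j : ℕ) :
    Exec [multiply R] (mem R low [a, encodeUnary i, w, d, n, [], encodeUnary j, []])
      (i * (copyTime A j + 3) + ((symbols A).length + 4) * (i * j) + 3)
      (PMF.pure (mem R low [a, encodeUnary (i * j), w, d, n, [], encodeUnary j, []])) := by
  have h (l : ℕ) : Exec [.loop (R + 1) Option.isSome
      (.seq (.pop (R + 1)) (copy (R + 6) (R + 7) (R + 5)))]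
      (mem R low [a, encodeUnary i, w, d, n, [], encodeUnary j, encodeUnary l])
      (i * (copyTime A j + 3) + 1)
      (PMF.pure (mem R low [a, [], w, d, n, [], encodeUnary j, encodeUnary (i * j + l)])) := by
    induction i generalizing l with
    | zero =>
      refine (exec_loop_false (by simp [encodeUnary])).of_eq rfl (by simp) ?_
      simp [encodeUnary]
    | succ i ih =>
      have h1 : Exec [.pop (R + 1)]
          (mem R low [a, encodeUnary (i + 1), w, d, n, [], encodeUnary j, encodeUnary l]) 1
          (PMF.pure (mem R low
            [a, encodeUnary i, w, d, n, [], encodeUnary j, encodeUnary l])) :=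
        exec_pop_high (by simp)
      have h2 : Exec [copy (R + 6) (R + 7) (R + 5)]
          (mem R low [a, encodeUnary i, w, d, n, [], encodeUnary j, encodeUnary l]) (copyTime A j)
          (PMF.pure (mem R low
            [a, encodeUnary i, w, d, n, [], encodeUnary j, encodeUnary (j + l)])) := by
        have := exec_copy_high (R := R) (i := 6) (j := 7) (B := j) (low := low)
          (hi := [a, encodeUnary i, w, d, n, [], encodeUnary j, encodeUnary l]) (by simp)
          (by simp) (by simp) (by simp) rfl (by simp [encodeUnary])
        refine this.of_eq rfl le_rfl ?_
        simp [encodeUnary]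
      refine (exec_loop_pure (by simp [encodeUnary, List.replicate_succ]) (h1.pure_seq h2)
        (ih (j + l))).of_eq rfl ?_ ?_
      · ring_nf
        omega
      · rw [Nat.succ_mul, Nat.add_assoc]
  refine ((h 0).pure_seq (exec_shift (by omega) _)).of_eq rfl ?_ ?_
  · simp [encodeUnary]
    omega
  · rw [update_mem_add _ _ (by simp), update_mem_add _ _ (by simp)]
    simp [encodeUnary]

/-- Multiply the number on stack `R + 1` by the `e`-th power of the number on stack `R + 6`. -/
noncomputable def multiplyPow (R : ℕ) : ℕ → Prog A
  | 0 => .skip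
  | e + 1 => .seq (multiplyPow R e) (multiply R)

/-- The running time of `multiplyPow`. -/
noncomputable def powTime (A : Type*) [Fintype A] (z : ℕ) : ℕ → ℕ
  | 0 => 1
  | e + 1 => powTime A z e +
      (z ^ e * (copyTime A z + 3) + ((symbols A).length + 4) * (z ^ e * z) + 3) + 1

theorem exec_multiplyPow {R : ℕ} {low : Stacks A} {a w d n : List (StackSymbol A)} (z e : ℕ) :
    Exec [multiplyPow R e] (mem R low [a, encodeUnary 1, w, d, n, [], encodeUnary z, []])
      (powTime A z e)
      (PMF.pure (mem R low [a, encodeUnary (z ^ e), w, d, n, [], encodeUnary z, []])) := by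
  induction e with
  | zero => exact exec_skip _
  | succ e ih =>
    rw [pow_succ]
    exact ih.pure_seq (exec_multiply _ _)

end Simulator

section Assembly

variable {A : Type*} [Fintype A]

/-- Compute the parameters of the simulation: on the inputs `a` and `m`, and with the program `M`
that computes the number `k` of outcome bits, put `(C + (k + m)) ^ e` on stack `R + 1` and `k` wild
cards on stack `R + 2`. -/
noncomputable def prepare (M : Prog A) (R C e : ℕ) : Prog A :=
  .seq (copy 0 (R + 0) (R + 5)) <| .seq (shift 1 (R + 6)) <| .seq M <| .seq (unpack R) <|
  .seq (clearBelow R) <| .seq (pushOnes (R + 6) C) <| .seq (.push (R + 1) (.bit true)) <|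
  .seq (multiplyPow R e) (clear (R + 6))

/-- The running time of `prepare`. -/
noncomputable def prepareTime (A : Type*) [Fintype A] (R C e l m k T : ℕ) : ℕ :=
  copyTime A l + ((symbols A).length + 4) * m + T + k * 6 + R * (2 * (l + T) + 2) + 2 * C +
    powTime A (C + (k + m)) e + 2 * (C + (k + m)) + 15

theorem exec_prepare {M : Prog A} {R C e m k T : ℕ} (hM : M.UsesBelow R) (hR : 4 ≤ R)
    {a : List (StackSymbol A)} {E : PMF (Stacks A)} (hE : Exec [M] (fill [a]) T E)
    (hk : E.map (fun s => s 0) = PMF.pure (encodeUnary k)) :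
    Exec [prepare M R C e] (fill [a, encodeUnary m]) (prepareTime A R C e a.length m k T)
      (PMF.pure (mem R (fun _ => [])
        [a, encodeUnary ((C + (k + m)) ^ e), List.replicate k .wild, [], [], [], [], []])) := by
  have h0 : fill [a, encodeUnary m] =
      mem R (fill [a, encodeUnary m]) [[], [], [], [], [], [], [], []] := by
    funext r
    by_cases hr : r < R
    · rw [mem_of_lt hr]
    · obtain ⟨i, rfl⟩ := Nat.exists_eq_add_of_le (not_lt.1 hr)
      rw [mem_add]
      have e1 : ([a, encodeUnary m] : List (List (StackSymbol A))).length ≤ R + i := by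
        simp; omega
      rw [fill, List.getD_eq_default _ _ e1]
      rcases i with _ | _ | _ | _ | _ | _ | _ | _ | i <;> rfl
  have h1 : Exec [copy 0 (R + 0) (R + 5)] (fill [a, encodeUnary m]) (copyTime A a.length)
      (PMF.pure (mem R (fill [a, encodeUnary m]) [a, [], [], [], [], [], [], []])) := by
    refine (exec_copy (B := a.length) (by omega) (by omega) (by omega) (by simp) ?_).of_eq h0
      le_rfl ?_
    · rw [mem_of_lt (by omega)]
      rfl
    · rw [update_mem_add _ _ (by simp), mem_of_lt (by omega), mem_add]
      simp [fill]
  have h2 : Exec [shift 1 (R + 6)] (mem R (fill [a, encodeUnary m]) [a, [], [], [], [], [], [], []])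
      (((symbols A).length + 4) * m + 1)
      (PMF.pure (mem R (fill [a]) [a, [], [], [], [], [], encodeUnary m, []])) := by
    have e1 : mem R (fill [a, encodeUnary m]) [a, [], [], [], [], [], [], []] 1 =
      encodeUnary m := mem_of_lt (by omega) _ _
    have e2 : fill [a, []] = fill [a] := by
      funext r
      rcases r with _ | _ | r <;> rfl
    refine (exec_shift (by omega) _).of_eq rfl ?_ ?_
    · rw [e1]
      simp [encodeUnary]
    · rw [e1, update_mem_of_lt (by omega), update_mem_add _ _ (by simp), update_fill (by simp)]
      simp [e2, encodeUnary]
  have h3 := hE.mem hM [a, [], [], [], [], [], encodeUnary m, []]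
  have h4 (s : Stacks A) (hs : s ∈ E.support) : Exec [unpack R]
      (mem R s [a, [], [], [], [], [], encodeUnary m, []]) (k * 6 + 1)
      (PMF.pure (mem R (Function.update s 0 [])
        [a, [], List.replicate k .wild, [], [], [], encodeUnary (k + m), []])) := by
    have hs0 : s 0 = encodeUnary k := by
      have : s 0 ∈ (E.map fun s => s 0).support :=
        (PMF.mem_support_map_iff _ _ _).2 ⟨s, hs, rfl⟩
      simpa [hk] using this
    exact exec_unpack (by omega) hs0 0 m
  have h5 (s : Stacks A) (hs : s ∈ E.support) : Exec [clearBelow R]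
      (mem R (Function.update s 0 [])
        [a, [], List.replicate k .wild, [], [], [], encodeUnary (k + m), []])
      (R * (2 * (a.length + T) + 2) + 1)
      (PMF.pure (mem R (fun _ => [])
        [a, [], List.replicate k .wild, [], [], [], encodeUnary (k + m), []])) := by
    refine exec_clearBelow_mem _ fun r hr => ?_
    rcases eq_or_ne r 0 with rfl | h
    · simp
    · rw [Function.update_of_ne h]
      refine (hE.length_le hs r).trans (Nat.add_le_add_right ?_ T)
      rcases r with _ | r <;> simp [fill]
  have h6 := exec_pushOnes (R := R) (low := fun _ => []) (a := a) (g := [])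
    (w := List.replicate k .wild) (d := []) (n := []) (t := []) (y := []) C (k + m)
  have h7 : Exec [.push (R + 1) (.bit true)] (mem R (fun _ => [])
        [a, [], List.replicate k .wild, [], [], [], encodeUnary (C + (k + m)), []]) 1
      (PMF.pure (mem R (fun _ => []) [a, encodeUnary 1, List.replicate k .wild, [], [], [],
        encodeUnary (C + (k + m)), []])) := exec_push_high (by simp) _
  have h8 := exec_multiplyPow (R := R) (low := fun _ => []) (a := a)
    (w := List.replicate k .wild) (d := []) (n := []) (C + (k + m)) e
  have h9 : Exec [clear (R + 6)] (mem R (fun _ => []) [a, encodeUnary ((C + (k + m)) ^ e),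
        List.replicate k .wild, [], [], [], encodeUnary (C + (k + m)), []])
      (2 * (C + (k + m)) + 1)
      (PMF.pure (mem R (fun _ => [])
        [a, encodeUnary ((C + (k + m)) ^ e), List.replicate k .wild, [], [], [], [], []])) := by
    refine (exec_clear _ _).of_eq rfl ?_ ?_
    · simp [encodeUnary]
    · rw [update_mem_add _ _ (by simp)]
      simp
  refine (h1.pure_seq (h2.pure_seq (h3.seq_map fun s hs => (h4 s hs).pure_seq ((h5 s hs).pure_seq
    (h6.pure_seq (h7.pure_seq (h8.pure_seq h9))))))).of_eq rfl ?_ ?_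
  · rw [prepareTime]
    omega
  · rw [PMF.bind_const]

/-- The simulator built from a program `M` that computes the number of outcome bits and a
poly-box `M'`. -/
noncomputable def simulator (M M' : Prog A) (R C e : ℕ) : Prog A :=
  .seq (prepare M R C e) <| .seq (.loop (R + 2) Option.isSome (drawBit M' R))
    (copy (R + 3) 0 (R + 5))

/-- The running time of `simulator`. -/
noncomputable def simulatorTime (A : Type*) [Fintype A] (R C e l m k T T' : ℕ) : ℕ :=
  prepareTime A R C e l m k T + k * (drawTime A R (l + k + (C + (k + m)) ^ e) T' + 1) +
    copyTime A k + 3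

theorem exec_simulator {M M' : Prog A} {R C e m k T T' : ℕ} (hM : M.UsesBelow R)
    (hM' : M'.UsesBelow R) (hR : 4 ≤ R) {a : List (StackSymbol A)} {E : PMF (Stacks A)}
    (hE : Exec [M] (fill [a]) T E) (hk : E.map (fun s => s 0) = PMF.pure (encodeUnary k))
    {μ : List Bool → Bool → PMF (List (StackSymbol A))}
    (hμ : ∀ D b, D.length < k → ∃ E, Exec [M'] (fill [a, encodeUnary ((C + (k + m)) ^ e),
      encodeUnary ((C + (k + m)) ^ e), List.replicate (k - D.length - 1) .wild ++
        (b :: D).map .bit]) T' E ∧ μ D b = E.map fun s => s 0) :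
    ∃ F, Exec [simulator M M' R C e] (fill [a, encodeUnary m])
        (simulatorTime A R C e a.length m k T T') F ∧
      (F.map fun s => s 0) = (chainLaw (fun D =>
        rejectionLaw (trialLaw (μ D)) ((C + (k + m)) ^ e) true) k).map encodeBits := by
  have h1 := exec_prepare (C := C) (e := e) (m := m) hM hR hE hk
  have h2 := exec_drawBits (B := a.length + k + (C + (k + m)) ^ e) (i := k) (D := []) hM' hR hμ
    (by omega) (by simp [encodeUnary]) (by omega) rfl
  rw [extendLaw_nil, PMF.map_comp] at h2
  set q : List Bool → PMF Bool := fun D =>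
    rejectionLaw (trialLaw (μ D)) ((C + (k + m)) ^ e) true with hq
  have hq' : (fun D => rejectionLaw (trialLaw (μ D))
      (encodeUnary ((C + (k + m)) ^ e) : List (StackSymbol A)).length true) = q := by
    simp [hq, encodeUnary]
  rw [hq'] at h2
  have hcopy (x : Fin k → Bool) := exec_copy_low (R := R) (i := 3) (r := 0)
    (L := [[], [], [], []]) (B := k) (hi := [a, encodeUnary ((C + (k + m)) ^ e), [],
      (List.ofFn x).map .bit, [], [], [], []]) (by omega) (by simp) (by simp) rfl (by simp)
  rw [← fill_nil] at hcopy
  have h3 := h1.pure_seq (h2.seq_map fun x _ => hcopy x)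
  refine ⟨_, h3.mono ?_, ?_⟩
  · rw [simulatorTime]
    omega
  · rw [PMF.map_bind]
    simp only [PMF.pure_map]
    change (chainLaw q k).map _ = _
    congr 1
    funext x
    rw [mem_of_lt (by omega)]
    simp [fill, encodeBits, List.map_ofFn, Function.comp_def]

end Assembly

/-! ## Suffix events -/

section SuffixEvents

/-- The event that the outcome ends in `L`. -/
def suffixPattern (k : ℕ) (L : List Bool) : Fin k → Option Bool := fun i =>
  (List.replicate (k - L.length) none ++ L.map some).getD i none

theorem encodePattern_suffixPattern {A : Type*} {k : ℕ} {L : List Bool} (hL : L.length ≤ k) :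
    (encodePattern (suffixPattern k L) : List (StackSymbol A)) =
      List.replicate (k - L.length) .wild ++ L.map .bit := by
  apply List.ext_getElem
  · simp [encodePattern, hL]
  · intro i h1 h2
    simp only [encodePattern, List.getElem_ofFn, suffixPattern, List.getElem_append,
      List.getD_eq_getElem?_getD, List.getElem?_append, List.length_replicate]
    split_ifs with h
    · simp [h]
    · have : i - (k - L.length) < L.length := by simp at h2; omega
      simp [this]

theorem mem_patternEvent_suffixPattern {k : ℕ} {L : List Bool} (hL : L.length ≤ k)
    (x : Fin k → Bool) : x ∈ patternEvent (suffixPattern k L) ↔ L <:+ List.ofFn x := by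
  rw [List.suffix_iff_eq_drop, patternEvent, Finset.mem_filter]
  simp only [Finset.mem_univ, true_and, List.length_ofFn]
  constructor
  · intro h
    apply List.ext_getElem
    · simp; omega
    · intro i h1 h2
      have := h ⟨k - L.length + i, by omega⟩
      simpa [suffixPattern, List.getElem?_append, h1] using this
  · intro h i
    rcases lt_or_ge i.1 (k - L.length) with hi | hi
    · left
      simp [suffixPattern, List.getElem?_append, hi]
    · right
      have hi' : i.1 - (k - L.length) < L.length := by omega
      have h1 : L[i.1 - (k - L.length)]? = (List.ofFn x)[i.1]? := by
        refine (congrArg (fun l => l[i.1 - (k - L.length)]?) h).trans ?_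
        simp only [List.getElem?_drop]
        congr 1
        omega
      rw [List.getElem?_eq_getElem hi', List.getElem?_eq_getElem (by simp)] at h1
      simpa [suffixPattern, List.getElem?_append, not_lt.2 hi, hi'] using h1

theorem QuantumCircuit.toReal_dist (c : QuantumCircuit) (x : Fin c.k → Bool) :
    (c.dist x).toReal = c.bornProb x := by
  rw [QuantumCircuit.dist, PMF.ofFintype_apply, ENNReal.toReal_ofReal (c.bornProb_nonneg x)]

theorem QuantumCircuit.eventProb_suffixPattern (c : QuantumCircuit) {L : List Bool}
    (hL : L.length ≤ c.k) :
    c.eventProb (suffixPattern c.k L) = suffixMass (fun x => (c.dist x).toReal) L := by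
  classical
  rw [QuantumCircuit.eventProb, suffixMass, ← Finset.sum_filter]
  refine Finset.sum_congr ?_ fun x _ => (c.toReal_dist x).symm
  ext x
  rw [mem_patternEvent_suffixPattern hL, Finset.mem_filter]
  simp

theorem precisionIndex_one_div {G : ℕ} : precisionIndex (1 / (G : ℝ)) = G := by
  simp [precisionIndex]

theorem confidenceIndex_half_pow (G : ℕ) : confidenceIndex ((1 / 2) ^ G) = G := by
  have : (1 : ℝ) / (1 / 2) ^ G = 2 ^ (G : ℝ) := by
    rw [Real.rpow_natCast]; simp
  rw [confidenceIndex, this, Real.logb_rpow (by norm_num) (by norm_num), Nat.ceil_natCast]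

end SuffixEvents

/-! ## Polynomial bounds -/

section PolyBounds

/-- `f` is bounded by a polynomial in `sz`. -/
def PolyBounded {ι : Type*} (sz f : ι → ℕ) : Prop := ∃ P : Polynomial ℕ, ∀ i, f i ≤ P.eval (sz i)

theorem Polynomial.eval_nat_mono (P : Polynomial ℕ) {x y : ℕ} (h : x ≤ y) : P.eval x ≤ P.eval y := by
  rw [Polynomial.eval_eq_sum, Polynomial.eval_eq_sum]
  exact Finset.sum_le_sum fun i _ => Nat.mul_le_mul_left _ (Nat.pow_le_pow_left h i)

variable {ι : Type*} {sz f g : ι → ℕ}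

theorem PolyBounded.const (c : ℕ) : PolyBounded sz fun _ => c := ⟨.C c, fun i => by simp⟩

theorem PolyBounded.mono (hg : PolyBounded sz g) (h : ∀ i, f i ≤ g i) : PolyBounded sz f :=
  hg.imp fun _ hP i => (h i).trans (hP i)

theorem PolyBounded.of_le (h : ∀ i, f i ≤ sz i) : PolyBounded sz f := ⟨.X, fun i => by simp [h]⟩

theorem PolyBounded.add (hf : PolyBounded sz f) (hg : PolyBounded sz g) :
    PolyBounded sz fun i => f i + g i := by
  obtain ⟨P, hP⟩ := hf
  obtain ⟨Q, hQ⟩ := hg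
  exact ⟨P + Q, fun i => by rw [Polynomial.eval_add]; exact add_le_add (hP i) (hQ i)⟩

theorem PolyBounded.mul (hf : PolyBounded sz f) (hg : PolyBounded sz g) :
    PolyBounded sz fun i => f i * g i := by
  obtain ⟨P, hP⟩ := hf
  obtain ⟨Q, hQ⟩ := hg
  exact ⟨P * Q, fun i => by rw [Polynomial.eval_mul]; exact Nat.mul_le_mul (hP i) (hQ i)⟩

theorem PolyBounded.pow (hf : PolyBounded sz f) (n : ℕ) : PolyBounded sz fun i => f i ^ n := by
  obtain ⟨P, hP⟩ := hf
  exact ⟨P ^ n, fun i => by rw [Polynomial.eval_pow]; exact Nat.pow_le_pow_left (hP i) n⟩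

theorem PolyBounded.eval (hf : PolyBounded sz f) (P : Polynomial ℕ) :
    PolyBounded sz fun i => P.eval (f i) := by
  obtain ⟨Q, hQ⟩ := hf
  exact ⟨P.comp Q, fun i => by rw [Polynomial.eval_comp]; exact P.eval_nat_mono (hQ i)⟩

theorem PolyBounded.copyTime (A : Type*) [Fintype A] (hf : PolyBounded sz f) :
    PolyBounded sz fun i => copyTime A (f i) := ((const _).mul hf).add (const _)

theorem PolyBounded.powTime (A : Type*) [Fintype A] (hf : PolyBounded sz f) (e : ℕ) :
    PolyBounded sz fun i => powTime A (f i) e := by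
  induction e with
  | zero => exact const 1
  | succ e ih =>
    exact (ih.add ((((hf.pow e).mul ((hf.copyTime A).add (const 3))).add
      ((const _).mul ((hf.pow e).mul hf))).add (const 3))).add (const 1)

theorem PolyBounded.drawTime (A : Type*) [Fintype A] (R : ℕ) (hf : PolyBounded sz f)
    (hg : PolyBounded sz g) : PolyBounded sz fun i => drawTime A R (f i) (g i) := by
  have hL := hf.add hg
  have hclean : PolyBounded sz fun i => cleanTime R (f i) (f i + g i) :=
    ((hL.mul ((((const 2).mul hf).add ((const 2).mul hL)).add (const 14))).add
      ((const R).mul (((const 2).mul hL).add (const 2)))).add (const 3)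
  have htrial : PolyBounded sz fun i => trialTime A R (f i) (g i) :=
    ((((const 5).mul (hf.copyTime A)).add hg).add hclean).add (const 12)
  exact ((hf.copyTime A).add (hf.mul (htrial.add (const 1)))).add (const 6)

theorem PolyBounded.simulatorTime (A : Type*) [Fintype A] (R C e : ℕ) {l m k T T' : ι → ℕ}
    (hl : PolyBounded sz l) (hm : PolyBounded sz m) (hk : PolyBounded sz k)
    (hT : PolyBounded sz T) (hT' : PolyBounded sz T') :
    PolyBounded sz fun i => simulatorTime A R C e (l i) (m i) (k i) (T i) (T' i) := by
  have hz : PolyBounded sz fun i => C + (k i + m i) := (const C).add (hk.add hm)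
  have hprep : PolyBounded sz fun i => prepareTime A R C e (l i) (m i) (k i) (T i) :=
    ((((((((hl.copyTime A).add ((const _).mul hm)).add hT).add (hk.mul (const 6))).add
      ((const R).mul (((const 2).mul (hl.add hT)).add (const 2)))).add (const _)).add
      (hz.powTime A e)).add ((const 2).mul hz)).add (const 15)
  exact ((hprep.add (hk.mul ((PolyBounded.drawTime A R ((hl.add hk).add (hz.pow e)) hT').add
    (const 1)))).add (hk.copyTime A)).add (const 3)

theorem Polynomial.exists_eval_le (P : Polynomial ℝ) :
    ∃ c d : ℕ, ∀ x : ℝ, 0 ≤ x → P.eval x ≤ c * (x + 1) ^ d := by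
  refine ⟨⌈∑ i ∈ Finset.range (P.natDegree + 1), |P.coeff i|⌉₊, P.natDegree, fun x hx => ?_⟩
  rw [Polynomial.eval_eq_sum_range]
  refine le_trans ?_ (mul_le_mul_of_nonneg_right (Nat.le_ceil _) (by positivity))
  rw [Finset.sum_mul]
  refine Finset.sum_le_sum fun i hi => ?_
  have h1 : x ^ i ≤ (x + 1) ^ P.natDegree :=
    (pow_le_pow_left₀ hx (by linarith) i).trans
      (pow_le_pow_right₀ (by linarith) (Nat.lt_succ_iff.1 (Finset.mem_range.1 hi)))
  exact mul_le_mul (le_abs_self _) h1 (by positivity) (abs_nonneg _)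

end PolyBounds

section Main

variable {A : Type*}

/-- The precision used by the simulator suffices. -/
theorem precision_le {c d k m z : ℕ} (hz : c + 192 + (k + m) = z) :
    192 * k * (c * (4 * k * (k + 1) * m + 1) ^ d) * m ≤ z ^ (4 * d + 4) := by
  have h1 : 4 * k * (k + 1) * m + 1 ≤ z ^ 4 := by
    have : 5 * (k + 1) * (k + 1) * (m + 1) ≤ z * z * z * z := by gcongr <;> omega
    nlinarith [this, Nat.zero_le (k * m), Nat.zero_le (k * k * m)]
  calc 192 * k * (c * (4 * k * (k + 1) * m + 1) ^ d) * m ≤ z * z * (z * (z ^ 4) ^ d) * z := by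
        gcongr <;> omega
    _ = z ^ (4 * d + 4) := by ring

/-- The conditional distributions produced by a poly-box of precision `1 / G` and `G` trials. -/
theorem stepError_rejectionLaw_le {m : List Bool → ℝ} {D : List Bool} {G : ℕ} (hG : 0 < G)
    (hm : m D = m (false :: D) + m (true :: D)) (h0 : ∀ b, 0 ≤ m (b :: D))
    (h1 : ∀ b, m (b :: D) ≤ 1) {μ : List Bool → Bool → PMF (List (StackSymbol A))}
    (hμ : ∀ b, (μ D b).toOuterMeasure {w | 1 / (G : ℝ) ≤ |m (b :: D) - estimateValue w|} ≤
      ENNReal.ofReal ((1 / 2) ^ G)) :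
    stepError m (fun D => rejectionLaw (trialLaw (μ D)) G true) D ≤ 96 / G := by
  have hG' : (0 : ℝ) < G := by exact_mod_cast hG
  have hpow : ((1 : ℝ) / 2) ^ G ≤ 1 / G := by
    rw [div_pow, one_pow]
    apply one_div_le_one_div_of_le hG'
    exact_mod_cast Nat.lt_two_pow_self.le
  have hτ (b : Bool) : |(trialLaw (μ D) (b, true)).toReal - m (b :: D) / 4| ≤ 2 / G := by
    refine (trialLaw_error_le (μ D) (v := fun b => m (b :: D)) h0 h1 (by positivity)
      (by positivity) hμ b).trans ?_
    have : (2 : ℝ) / G = 1 / G + 1 / G := by ring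
    linarith
  have key (b : Bool) := rejectionLaw_error_le (trialLaw (μ D)) hG true
    (m := fun b => m (b :: D)) hτ b
  simp only [← hm] at key
  have e : (96 : ℝ) / G = 2 * (8 / G + 20 * (2 / G)) := by ring
  rw [stepError, e]
  linarith [key false, key true]

/-- With the chosen precision, bit by bit sampling is accurate. -/
theorem l1Dist_chainLaw_le_of_precision {k : ℕ} {p : PMF (Fin k → Bool)} {q : List Bool → PMF Bool}
    {t m G : ℕ} (hm : 0 < m) (hG : 0 < G)
    (hp : IsApproxSparse (1 / (4 * (k + 1) * m)) t p) (hGt : 192 * k * t * m ≤ G)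
    (hq : ∀ D, D.length < k → stepError (suffixMass fun x => (p x).toReal) q D ≤ 96 / G) :
    l1Dist p (chainLaw q k) ≤ 1 / m := by
  have hG' : (0 : ℝ) < G := by exact_mod_cast hG
  have hm' : (0 : ℝ) < m := by exact_mod_cast hm
  refine (l1Dist_chainLaw_le p q hp (by positivity) hq).trans ?_
  have h1 : (k : ℝ) * (t * (96 / G)) ≤ 1 / (2 * m) := by
    have e : (k : ℝ) * (t * (96 / G)) = (96 * k * t) / G := by ring
    rw [e, div_le_div_iff₀ hG' (by positivity)]
    have : (192 * k * t * m : ℝ) ≤ G := by exact_mod_cast hGt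
    linarith
  have h2 : (k : ℝ) * (2 * (1 / (4 * (k + 1) * m))) ≤ 1 / (2 * m) := by
    have e : (k : ℝ) * (2 * (1 / (4 * (k + 1) * m))) = (k / (k + 1)) * (1 / (2 * m)) := by
      field_simp
      ring
    rw [e]
    refine mul_le_of_le_one_left (by positivity) ?_
    rw [div_le_one (by positivity)]
    linarith
  have e : (1 : ℝ) / m = 1 / (2 * m) + 1 / (2 * m) := by field_simp; ring
  rw [e, mul_add]
  linarith

end Main

theorem mainTheorem1 {A : Type*} [Fintype A] (C : List A → QuantumCircuit)
    (hC : IsUniform C) (hbox : ∃ M : Prog A, IsPolyBox C M)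
    (hsparse : IsPolySparse fun a => (C a).dist) :
    ∃ M : Prog A, IsEpsilonSimulator C M := by
  obtain ⟨M, PT, hM⟩ := hC.outcome_bits
  obtain ⟨PL, hPL⟩ := hC.length_le
  obtain ⟨M', PB, hM'⟩ := hbox
  obtain ⟨PS, hPS⟩ := hsparse
  obtain ⟨c, d, hcd⟩ := PS.exists_eval_le
  obtain ⟨R₁, hR₁⟩ := M.exists_usesBelow
  obtain ⟨R₂, hR₂⟩ := M'.exists_usesBelow
  set R := max 4 (max R₁ R₂) with hR
  set e := 4 * d + 4 with he
  let G : List A × ℕ → ℕ := fun i => (c + 192 + ((C i.1).k + i.2)) ^ e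
  let T : List A × ℕ → ℕ := fun i => PT.eval (C i.1).n
  let T' : List A × ℕ → ℕ := fun i => PB.eval ((C i.1).n + G i + G i)
  have hE (a : List A) : Exec [M] (fill [encodeWord a]) (T (a, 0)) _ :=
    exec_of_halts (hM a).1
  have hEk (a : List A) := (hM a).2
  have hk (a : List A) : (C a).k ≤ a.length + T (a, 0) := by
    obtain ⟨s, hs⟩ := ((Cfg.run (T (a, 0)) ⟨[M], fill [encodeWord a]⟩).map Cfg.stk).support_nonempty
    have h1 := (hE a).length_le hs 0
    have h2 : s 0 ∈ (M.output [encodeWord a] (T (a, 0))).support := by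
      obtain ⟨c, hc, rfl⟩ := (PMF.mem_support_map_iff _ _ _).1 hs
      exact (PMF.mem_support_map_iff _ _ _).2 ⟨c, hc, rfl⟩
    rw [hEk a, PMF.support_pure, Set.mem_singleton_iff] at h2
    simpa [h2, fill, encodeUnary, encodeWord] using h1
  obtain ⟨P, hP⟩ : PolyBounded (fun i : List A × ℕ => (C i.1).n + i.2) fun i =>
      simulatorTime A R (c + 192) e i.1.length i.2 (C i.1).k (T i) (T' i) := by
    have hn : PolyBounded (fun i : List A × ℕ => (C i.1).n + i.2) fun i => (C i.1).n :=
      .of_le fun i => Nat.le_add_right _ _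
    have hm : PolyBounded (fun i : List A × ℕ => (C i.1).n + i.2) fun i => i.2 :=
      .of_le fun i => Nat.le_add_left _ _
    have hl : PolyBounded (fun i : List A × ℕ => (C i.1).n + i.2) fun i => i.1.length :=
      (hn.eval PL).mono fun i => hPL i.1
    have hT := hn.eval PT
    have hk' := (hl.add hT).mono fun i => hk i.1
    have hG := ((PolyBounded.const (c + 192)).add (hk'.add hm)).pow e
    exact .simulatorTime A R (c + 192) e hl hm hk' hT (((hn.add hG).add hG).eval PB)
  refine ⟨simulator M M' R (c + 192) e, P, fun a ε hε => ?_⟩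
  set m := precisionIndex ε with hm
  set k := (C a).k with hkdef
  set g := G (a, m) with hg
  have hm0 : 0 < m := Nat.ceil_pos.2 (by positivity)
  have hg0 : 0 < g := pow_pos (by omega) _
  let μ : List Bool → Bool → PMF (List (StackSymbol A)) := fun D b =>
    M'.output [encodeWord a, encodeUnary g, encodeUnary g,
      List.replicate (k - D.length - 1) .wild ++ (b :: D).map .bit] (T' (a, m))
  have hbox' (D : List Bool) (b : Bool) (hD : D.length < k) :
      M'.HaltsWithin [encodeWord a, encodeUnary g, encodeUnary g,
        List.replicate (k - D.length - 1) .wild ++ (b :: D).map .bit] (T' (a, m)) ∧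
      (μ D b).toOuterMeasure {w | 1 / (g : ℝ) ≤
        |suffixMass (fun x => ((C a).dist x).toReal) (b :: D) - estimateValue w|} ≤
          ENNReal.ofReal ((1 / 2) ^ g) := by
    have hlen : (b :: D).length ≤ k := hD
    have h := hM' a (1 / (g : ℝ)) ((1 / 2) ^ g) (by positivity) (by positivity)
      (suffixPattern k (b :: D))
    rw [precisionIndex_one_div, confidenceIndex_half_pow, encodePattern_suffixPattern hlen,
      (C a).eventProb_suffixPattern hlen, List.length_cons, ← Nat.sub_sub] at h
    exact h
  obtain ⟨F, hF, hF'⟩ := exec_simulator (C := c + 192) (e := e) (m := m)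
    (hR₁.mono (by omega : R₁ ≤ R)) (hR₂.mono (by omega : R₂ ≤ R)) (by omega) (hE a)
    (k := k) (by
      rw [← hEk a, PMF.map_comp]
      rfl) (μ := μ) (T' := T' (a, m)) fun D b hD =>
        ⟨_, exec_of_halts (hbox' D b hD).1, by rw [PMF.map_comp]; rfl⟩
  have hF := hF.mono ((hP (a, m)).trans' (by simp [encodeWord]; rfl))
  refine ⟨hF.halts, chainLaw (fun D => rejectionLaw (trialLaw (μ D)) g true) k, ?_, ?_⟩
  · rw [← hF', hF.eq_map_stk, PMF.map_comp]
    rfl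
  · have hm1 : 1 / (m : ℝ) ≤ ε := by
      rw [one_div_le (by exact_mod_cast hm0) hε]
      exact Nat.le_ceil _
    refine le_trans (l1Dist_chainLaw_le_of_precision
      (t := c * (4 * k * (k + 1) * m + 1) ^ d) hm0 hg0 (hPS _ (by positivity) a _ ?_)
      (precision_le rfl) fun D hD => ?_) hm1
    · refine (hcd _ (by positivity)).trans (le_of_eq ?_)
      push_cast
      rw [div_div_eq_mul_div, div_one]
      congr 3
      ring
    · refine stepError_rejectionLaw_le hg0 (suffixMass_cons _ hD)
        (fun b => suffixMass_nonneg (fun x => ENNReal.toReal_nonneg) _) (fun b => ?_)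
        fun b => (hbox' D b hD).2
      refine (suffixMass_le_sum (fun x => ENNReal.toReal_nonneg) _).trans (le_of_eq ?_)
      simp only [QuantumCircuit.toReal_dist]
      exact (C a).sum_bornProb
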